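/- Let $Q,M\ge 1$ and $\theta^{(1)}<\dots<\theta^{(Q)}$, let $a(\theta)\in\mathbb C^M$ be the steering vector with entries $e^{-j\frac{2\pi d m}{\lambda}\sin\theta}$ for $0\le m<M$, where $\lambda>0$ and $d=\lambda/2$, and let $A$ be the $Q\times M^2$ matrix with rows $A_i=a(\theta^{(i)})^T\otimes a(\theta^{(i)})^H$. Suppose that $A$ is given through two unitaries, and their inverses, with $$U_{\rm M}:|i\rangle|0\rangle\mapsto\frac1{\|A_i\|_2}\sum_j A_{ij}|i\rangle|j\rangle,\qquad U_{\rm N}:|0\rangle|j\rangle\mapsto\frac1{\|A\|_F}\sum_i\|A_i\|_2\,|i\rangle|j\rangle ,$$ where $i$ is held by a register of $\lceil\log_2 Q\rceil$ qubits and $j=(j_1,j_2)\in\{0,\dots,M-1\}^2$ by two registers of $\lceil\log_2 M\rceil$ qubits. One use of either unitary or of its inverse takes time $c_0(1+\log QM)^{k_0}$, where $c_0\ge0$ and $k_0\in\mathbb N$ are constants; an elementary gate (a unitary on at most three qubits) takes time $1$. Then there are constants $C>0$ and $k\in\mathbb N$, depending only on $c_0,k_0$, such that for all $Q,M\ge1$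 and $\varepsilon>0$ there is a quantum circuit made of elementary gates and uses of $U_{\rm M}^{\pm1},U_{\rm N}^{\pm1}$, depending only on $Q,M,\varepsilon$, which for every such $A$ has running time at most $$C\,\frac{\|A\|_F\,(1+\log QM)^k}{\varepsilon}$$ and which, for all unitaries $U_{\rm M},U_{\rm N}$ as above, implements the singular vector transition $$\mathrm T:\ \sum_i\beta_i|u_i\rangle\longmapsto\sum_i\beta_i|v_i\rangle$$ with the singular values resolved to accuracy $\varepsilon$, in the following sense. For every singular value decomposition $A=\sum_{i=1}^r\sigma_iu_iv_i^H$ with all $\sigma_i>0$ and orthonormal $u_1,\dots,u_r$ and $v_1,\dots,v_r$, and for all $\beta\in\mathbb C^r$, the circuit takes $\sum_i\beta_i|u_i\rangle$ (in the row register, all other qubits in state $|0\rangle$) to a state whose Euclidean distance from $\sum_i\beta_i|v_i\rangle$ (in the column registers, all other qubits in state $|0\rangle$) is at most $$\varepsilon\Big(\sum_i\frac{|\beta_i|^2}{\sigma_i^2}\Big)^{1/2}.$$ In particular, for a normalized state the distance is at most $\varepsilon$ if every $\sigma_i$ with $\beta_i\ne0$ is at least $1$, and at most $\varepsilon/\sigma_{\min}$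 always. -/

import Mathlib

open scoped Matrix

noncomputable section

/-! ### The matrix of steering rows -/

/-- The steering vector `a(θ)` of a uniform linear array of `M` antennas with spacing `d` and
wavelength `lam`; its `m`-th entry is `exp (-j 2π d m sin θ / lam)`, `m = 0, …, M - 1`. -/
def steeringVector (M : ℕ) (d lam θ : ℝ) : Fin M → ℂ := fun m =>
  Complex.exp (-Complex.I * ((2 * Real.pi * d * (m : ℕ) / lam * Real.sin θ : ℝ) : ℂ))

/-- The `Q × M²` matrix whose `q`-th row is `a(θ_q) ⊗ a(θ_q)*`. The `M²` columns are indexed by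
pairs, as usual for a Kronecker product. -/
def steeringMatrix {Q : ℕ} (M : ℕ) (d lam : ℝ) (θ : Fin Q → ℝ) :
    Matrix (Fin Q) (Fin M × Fin M) ℂ :=
  Matrix.of fun q j =>
    steeringVector M d lam (θ q) j.1 * star (steeringVector M d lam (θ q) j.2)

section FrobeniusNorm

open scoped Matrix.Norms.Frobenius

/-- The Frobenius norm. -/
def frobeniusNorm {m n : Type*} [Fintype m] [Fintype n] (A : Matrix m n ℂ) : ℝ := ‖A‖

end FrobeniusNorm

/-- The Euclidean norm of the `i`-th row. -/
def rowNorm {m n : Type*} [Fintype n] (A : Matrix m n ℂ) (i : m) : ℝ := ‖WithLp.toLp 2 (A i)‖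

/-- Economy-sized singular value decomposition `A = ∑ₖ σₖ uₖ vₖᴴ`: positive singular values (so
the number `r` of terms is the rank), orthonormal left and right singular vectors. -/
structure IsEconomySVD {m n : Type*} [Fintype m] [Fintype n] (A : Matrix m n ℂ) {r : ℕ}
    (σ : Fin r → ℝ) (u : Fin r → EuclideanSpace ℂ m) (v : Fin r → EuclideanSpace ℂ n) :
    Prop where
  pos : ∀ k, 0 < σ k
  left_orthonormal : Orthonormal ℂ u
  right_orthonormal : Orthonormal ℂ v
  eq_sum : ∀ i j, A i j = ∑ k, (σ k : ℂ) * u k i * star (v k j)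

/-! ### Qubits and registers

A set `ω` of qubits has computational basis `ω → Bool`; a state vector is a function
`(ω → Bool) → ℂ`, an operator a matrix indexed by `ω → Bool`. -/

/-- The qubits that hold a row index below `Q` and a column index in `{0, …, M-1}²`: one register
of `⌈log₂ Q⌉` qubits and two registers of `⌈log₂ M⌉` qubits. -/
abbrev DataQubit (Q M : ℕ) : Type :=
  Fin (Nat.clog 2 Q) ⊕ (Fin (Nat.clog 2 M) ⊕ Fin (Nat.clog 2 M))

/-- All qubits of a machine: the data registers and `a` ancillas. -/
abbrev Qubit (Q M a : ℕ) : Type := DataQubit Q M ⊕ Fin a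

/-- The lowest `n` binary digits of `x`. -/
def bits (n x : ℕ) : Fin n → Bool := fun t => x.testBit t

/-- The basis state `|i⟩|j⟩` of the data registers, `j = (j₁, j₂)`. -/
def ket (Q M i j₁ j₂ : ℕ) : (DataQubit Q M → Bool) → ℂ :=
  Pi.single (Sum.elim (bits _ i) (Sum.elim (bits _ j₁) (bits _ j₂))) 1

open Classical in
/-- The state `ψ ⊗ |0…0⟩`, with all ancillas in state zero. -/
def withAncillas {Q M : ℕ} (a : ℕ) (ψ : (DataQubit Q M → Bool) → ℂ) :
    (Qubit Q M a → Bool) → ℂ :=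
  fun x => if ∀ t, x (Sum.inr t) = false then ψ (x ∘ Sum.inl) else 0

open Classical in
/-- The operator `G` applied to the qubits selected by `e`, tensored with the identity on all the
other qubits. -/
def actOn {κ ω : Type*} (e : κ ↪ ω) (G : Matrix (κ → Bool) (κ → Bool) ℂ) :
    Matrix (ω → Bool) (ω → Bool) ℂ :=
  Matrix.of fun x y => if ∀ w, w ∉ Set.range e → x w = y w then G (x ∘ e) (y ∘ e) else 0

/-! ### The two unitaries that give access to the matrix -/

/-- `U_M : |i⟩|0⟩ ↦ ‖A_i‖⁻¹ ∑ⱼ A_ij |i⟩|j⟩`. -/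
def IsRowLoader {Q M : ℕ} (A : Matrix (Fin Q) (Fin M × Fin M) ℂ)
    (U : Matrix (DataQubit Q M → Bool) (DataQubit Q M → Bool) ℂ) : Prop :=
  ∀ i : Fin Q, U *ᵥ ket Q M i 0 0 =
    ∑ j : Fin M × Fin M, (A i j / (rowNorm A i : ℂ)) • ket Q M i j.1 j.2

/-- `U_N : |0⟩|j⟩ ↦ ‖A‖_F⁻¹ ∑ᵢ ‖A_i‖ |i⟩|j⟩`. -/
def IsNormLoader {Q M : ℕ} (A : Matrix (Fin Q) (Fin M × Fin M) ℂ)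
    (U : Matrix (DataQubit Q M → Bool) (DataQubit Q M → Bool) ℂ) : Prop :=
  ∀ j : Fin M × Fin M, U *ᵥ ket Q M 0 j.1 j.2 =
    ∑ i : Fin Q, ((rowNorm A i : ℂ) / (frobeniusNorm A : ℂ)) • ket Q M i j.1 j.2

/-! ### Quantum circuits with access to `U_M` and `U_N` -/

/-- One step of a circuit: an elementary gate, that is an arbitrary unitary on at most three
qubits, or a use of `U_M`, `U_M⁻¹`, `U_N` or `U_N⁻¹` on the data registers. -/
inductive Step (Q M a : ℕ) : Type
  | gate (n : ℕ) (hn : n ≤ 3) (e : Fin n ↪ Qubit Q M a)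
      (G : Matrix.unitaryGroup (Fin n → Bool) ℂ) : Step Q M a
  | useM : Step Q M a
  | useMInv : Step Q M a
  | useN : Step Q M a
  | useNInv : Step Q M a

/-- The operator that a step performs, when `U_M` and `U_N` are the given unitaries. -/
def Step.op {Q M a : ℕ} (UM UN : Matrix.unitaryGroup (DataQubit Q M → Bool) ℂ) :
    Step Q M a → Matrix (Qubit Q M a → Bool) (Qubit Q M a → Bool) ℂ
  | .gate _ _ e G => actOn e G.1
  | .useM => actOn Function.Embedding.inl UM.1
  | .useMInv => actOn Function.Embedding.inl (UM⁻¹).1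
  | .useN => actOn Function.Embedding.inl UN.1
  | .useNInv => actOn Function.Embedding.inl (UN⁻¹).1

/-- The running time of a step, if one use of `U_M`, `U_N` or an inverse takes time `τ` and an
elementary gate takes time one. -/
def Step.time {Q M a : ℕ} (τ : ℝ) : Step Q M a → ℝ
  | .gate _ _ _ _ => 1
  | .useM => τ
  | .useMInv => τ
  | .useN => τ
  | .useNInv => τ

/-- A circuit is the list of its steps, in order of execution. -/
abbrev Circuit (Q M a : ℕ) : Type := List (Step Q M a)

/-- The operator that a circuit performs. -/
def circuitOp {Q M a : ℕ} (UM UN : Matrix.unitaryGroup (DataQubit Q M → Bool) ℂ) :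
    Circuit Q M a → Matrix (Qubit Q M a → Bool) (Qubit Q M a → Bool) ℂ
  | [] => 1
  | s :: c => circuitOp UM UN c * s.op UM UN

/-- The running time of a circuit. -/
def circuitTime {Q M a : ℕ} (τ : ℝ) (c : Circuit Q M a) : ℝ := (c.map (Step.time τ)).sum

/-- A vector `y` of `ℂ^Q` in the row register, everything else being in state zero. -/
def rowState {Q : ℕ} (M a : ℕ) (y : EuclideanSpace ℂ (Fin Q)) : (Qubit Q M a → Bool) → ℂ :=
  withAncillas a (∑ i : Fin Q, y i • ket Q M i 0 0)

/-- A vector `z` of `ℂ^(M²)` in the column registers, everything else being in state zero. -/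
def columnState (Q : ℕ) {M : ℕ} (a : ℕ) (z : EuclideanSpace ℂ (Fin M × Fin M)) :
    (Qubit Q M a → Bool) → ℂ :=
  withAncillas a (∑ j : Fin M × Fin M, z j • ket Q M 0 j.1 j.2)

end

/-! ### Fejér–Riesz factorisation and quantum signal processing on the unit circle. -/

noncomputable section CirclePolynomials

open Polynomial

/-! Put `B = U_N⁻¹ U_M` and `F = ‖A‖_F`. The block of `B` from `|i⟩|0⟩` to `|0⟩|j⟩` is `Aᵀ / F`
(`loader_overlap`). For steering rows, conjugating `A` exchanges the two column indices, so `Aᵀ` is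
`Aᴴ` followed by that exchange. Let `w k` be `Bᴴ` applied to the exchanged `v k`. Then `u k` and `w
k` enclose an angle `θ k` with cosine `σ k / F`, and the reflections `Z₁` (in the row states) and
`Z₃` (in the column states, conjugated by `B`) preserve the plane they span
(`reflectionPair_steeringMatrix`). There the walk `W = Z₃ Z₁` is the rotation by `2 θ k` from `u k`
towards `w k`. The transition is thus a square root of `W`, followed by `B` and the exchange of the
column registers.

The square root has its branch cut at `θ = π/2`, that is at singular value zero, so it is only
approximated. Averaging square roots over roots of unity with a Jackson kernel gives a polynomial
`P` of degree `4 (L - 1)` with `P(z) ≈ z^(2(L-1)) √z` (`exists_half_power_polynomial`), and `2 (L -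
1)` inverse walks remove the monomial. The loss `1 - Re` of the overlap is at most `3 / (L² cos²
θ)`. A squared distance is twice such a loss, so the squared error is at most `6 F² / L² ∑ |β k|² /
σ k²`, and `L` of order `F / ε` suffices.

To apply `P(W)`, Fejér–Riesz provides a complementary `q` with `|P|² + |q|² = 1` on the circle
(`exists_complementary`), and the pair `(P, q)` factors into single-qubit rotations interleaved with
controlled walks (`exists_rotationPolys`). The combined map is an isometry, so the error, including
the amplitude left on the wrong control value, depends only on the overlap of `P(W)` with the target
(`ReflectionPair.transition_error`); no spectral theorem is needed. Each reflection costs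
logarithmically many gates: comparators compute flags, a sign is applied, and the flags are
uncomputed (`circuitOp_reflectionCircuit`). -/

theorem infinite_unit_circle : {z : ℂ | ‖z‖ = 1}.Infinite := by
  refine Set.infinite_of_injective_forall_mem
    (f := fun n : ℕ => Complex.exp (2 * Real.pi * Complex.I / ((n + 1 : ℕ) : ℂ))) ?_ ?_
  · intro m n h
    have hm := Complex.isPrimitiveRoot_exp (m + 1) (by omega)
    have hn := Complex.isPrimitiveRoot_exp (n + 1) (by omega)
    simp only at h
    rw [h] at hm
    have := hm.unique hn
    omega
  · intro n
    exact (Complex.isPrimitiveRoot_exp (n + 1) (by omega)).norm'_eq_one (by omega)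

theorem Polynomial.ext_of_circle {p q : ℂ[X]} (h : ∀ z : ℂ, ‖z‖ = 1 → p.eval z = q.eval z) :
    p = q :=
  Polynomial.eq_of_infinite_eval_eq p q (infinite_unit_circle.mono fun z hz => h z hz)

/-- The polynomial `zⁿ conj (p (1 / conj z))`. -/
def conjReflect (n : ℕ) (p : ℂ[X]) : ℂ[X] := (p.map (starRingEnd ℂ)).reflect n

theorem coeff_conjReflect {n k : ℕ} (hk : k ≤ n) (p : ℂ[X]) :
    (conjReflect n p).coeff k = star (p.coeff (n - k)) := by
  rw [conjReflect, coeff_reflect, revAt_le hk, coeff_map]; rfl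

theorem natDegree_conjReflect_le {n : ℕ} {p : ℂ[X]} (hp : p.natDegree ≤ n) :
    (conjReflect n p).natDegree ≤ n := by
  refine natDegree_reflect_le.trans (max_le le_rfl ?_)
  exact natDegree_map_le.trans hp

theorem eval_map_star (p : ℂ[X]) (z : ℂ) :
    (p.map (starRingEnd ℂ)).eval z = star (p.eval (star z)) := by
  have := hom_eval₂ p (RingHom.id ℂ) (starRingEnd ℂ) (star z)
  rw [eval_map]
  simp only [RingHom.comp_id] at this
  rw [← eval₂_id (p := p) (x := star z)]
  change _ = starRingEnd ℂ _
  rw [this]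
  congr 1
  simp

theorem eval_conjReflect {n : ℕ} {p : ℂ[X]} (hp : p.natDegree ≤ n) {z : ℂ} (hz : z ≠ 0) :
    (conjReflect n p).eval z = z ^ n * star (p.eval (star z)⁻¹) := by
  have hdeg : (p.map (starRingEnd ℂ)).natDegree ≤ n := natDegree_map_le.trans hp
  let _ : Invertible z⁻¹ := invertibleOfNonzero (inv_ne_zero hz)
  have h := eval₂_reflect_mul_pow (RingHom.id ℂ) z⁻¹ n (p.map (starRingEnd ℂ)) hdeg
  simp only [invOf_eq_inv, inv_inv, eval₂_id] at h
  rw [eval_map_star] at h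
  have hs : star z⁻¹ = (star z)⁻¹ := star_inv₀ z
  rw [hs] at h
  rw [← h, conjReflect, mul_comm, mul_assoc, ← mul_pow, inv_mul_cancel₀ hz, one_pow, mul_one]

theorem star_eq_inv_of_norm_one {z : ℂ} (hz : ‖z‖ = 1) : star z = z⁻¹ := by
  rw [Complex.inv_def, Complex.normSq_eq_norm_sq, hz]; simp

theorem ne_zero_of_norm_one {z : ℂ} (hz : ‖z‖ = 1) : z ≠ 0 := by
  rintro rfl; simp at hz

theorem mul_star_self_eq (z : ℂ) : z * star z = ((‖z‖ ^ 2 : ℝ) : ℂ) := by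
  have := Complex.mul_conj z
  rw [Complex.normSq_eq_norm_sq] at this
  exact this

theorem eval_conjReflect_circle {n : ℕ} {p : ℂ[X]} (hp : p.natDegree ≤ n) {z : ℂ}
    (hz : ‖z‖ = 1) : (conjReflect n p).eval z = z ^ n * star (p.eval z) := by
  rw [eval_conjReflect hp (ne_zero_of_norm_one hz), star_eq_inv_of_norm_one hz, inv_inv]

/-- **Fejér–Riesz**: a strictly positive trigonometric polynomial of degree `n` is the squared
modulus of a polynomial of degree `n` on the unit circle. -/
theorem fejer_riesz (n : ℕ) (G : ℂ[X]) (hdeg : G.natDegree ≤ 2 * n) (g : ℂ → ℝ)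
    (hg : ∀ z : ℂ, ‖z‖ = 1 → 0 < g z ∧ G.eval z = z ^ n * (g z : ℂ)) :
    ∃ q : ℂ[X], q.natDegree ≤ n ∧ ∀ z : ℂ, ‖z‖ = 1 → ‖q.eval z‖ ^ 2 = g z := by
  induction n generalizing G g with
  | zero =>
    have hG : G = C (G.coeff 0) := eq_C_of_natDegree_le_zero (by simpa using hdeg)
    refine ⟨C ((Real.sqrt (g 1) : ℝ) : ℂ), by simp, fun z hz => ?_⟩
    have h1 := (hg 1 (by simp)).2
    have h2 := (hg z hz).2
    rw [hG] at h1 h2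
    simp only [eval_C, pow_zero, one_mul] at h1 h2
    have h3 : g z = g 1 := by exact_mod_cast h2.symm.trans h1
    rw [eval_C, Complex.norm_real, h3, Real.norm_eq_abs, sq_abs,
      Real.sq_sqrt (hg 1 (by simp)).1.le]
  | succ n ih =>
    -- As `g` is real, `G` equals its own reflection: coefficients are symmetric about the middle
    -- and roots come in pairs `α`, `1 / conj α`.
    have hself : conjReflect (2 * (n + 1)) G = G := by
      refine Polynomial.ext_of_circle fun z hz => ?_
      rw [eval_conjReflect_circle hdeg hz, (hg z hz).2, star_mul', star_pow,
        star_eq_inv_of_norm_one hz]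
      have : star ((g z : ℝ) : ℂ) = g z := Complex.conj_ofReal _
      rw [this]
      have h1 : z ^ (n + 1) * z⁻¹ ^ (n + 1) = 1 := by
        rw [← mul_pow, mul_inv_cancel₀ (ne_zero_of_norm_one hz), one_pow]
      linear_combination z ^ (n + 1) * g z * h1
    -- If the lowest coefficient vanishes, so does the one of degree `2 (n + 1)`, and removing a
    -- factor `X` lowers `n`.
    by_cases h0 : G.coeff 0 = 0
    · obtain ⟨H, rfl⟩ : X ∣ G := X_dvd_iff.2 h0
      have htop : (X * H).coeff (2 * n + 2) = 0 := by
        have := coeff_conjReflect (n := 2 * (n + 1)) (k := 0) (by omega) (X * H)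
        rw [hself, h0] at this
        have h2 := congrArg star this
        simp only [star_zero, star_star] at h2
        exact h2.symm
      have hH : H.natDegree ≤ 2 * n := by
        rw [natDegree_le_iff_coeff_eq_zero]
        intro k hk
        have : (X * H).coeff (k + 1) = 0 := by
          rcases eq_or_ne k (2 * n + 1) with rfl | hne
          · exact htop
          · exact coeff_eq_zero_of_natDegree_lt (by omega)
        rwa [coeff_X_mul] at this
      obtain ⟨q, hq, hq'⟩ := ih H hH g (fun z hz => ⟨(hg z hz).1, by
        have h := (hg z hz).2
        rw [eval_mul, eval_X, pow_succ', mul_assoc] at h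
        exact mul_left_cancel₀ (ne_zero_of_norm_one hz) h⟩)
      exact ⟨q, by omega, hq'⟩
    · have hd : 2 * n + 2 ≤ G.natDegree := by
        refine le_natDegree_of_ne_zero fun h => h0 ?_
        have := coeff_conjReflect (n := 2 * (n + 1)) (k := 0) (by omega) G
        rw [hself] at this
        rw [this]
        have e : 2 * (n + 1) - 0 = 2 * n + 2 := by omega
        rw [e, h, star_zero]
      obtain ⟨α, hα⟩ := Complex.exists_root (f := G)
        (natDegree_pos_iff_degree_pos.1 (by omega))
      have hα0 : α ≠ 0 := by
        rintro rfl
        exact h0 (by rw [coeff_zero_eq_eval_zero]; exact hα)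
      -- Strict positivity keeps roots off the circle, so `α` and its mirror image are distinct and
      -- no multiplicity count is needed.
      have hα1 : ‖α‖ ≠ 1 := fun h => by
        have := (hg α h).2
        rw [hα.eq_zero] at this
        have h2 := mul_ne_zero (pow_ne_zero (n + 1) hα0)
          (Complex.ofReal_ne_zero.2 (hg α h).1.ne')
        exact h2 this.symm
      set γ : ℂ := (star α)⁻¹ with hγ
      have hsα : star α ≠ 0 := by simpa using hα0
      have hγ0 : γ ≠ 0 := inv_ne_zero hsα
      have hγr : G.IsRoot γ := by
        have := eval_conjReflect hdeg hγ0
        rw [hself] at this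
        have h2 : (star γ)⁻¹ = α := by rw [hγ, star_inv₀, star_star, inv_inv]
        rw [h2, hα.eq_zero] at this
        simpa using this
      have hne : γ ≠ α := by
        intro h
        apply hα1
        have : α * star α = 1 := by
          nth_rewrite 1 [← h]
          rw [hγ, inv_mul_cancel₀ hsα]
        rw [mul_star_self_eq] at this
        have h2 : ‖α‖ ^ 2 = 1 := by exact_mod_cast this
        nlinarith [norm_nonneg α]
      obtain ⟨G1, hG1⟩ := dvd_iff_isRoot.2 hα
      have hγ1 : G1.IsRoot γ := by
        have := hγr
        rw [hG1, IsRoot, eval_mul, eval_sub, eval_X, eval_C] at this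
        exact (mul_eq_zero.1 this).resolve_left (sub_ne_zero.2 hne)
      obtain ⟨H, hH⟩ := dvd_iff_isRoot.2 hγ1
      have hG0 : G ≠ 0 := fun h => h0 (by simp [h])
      have hG10 : G1 ≠ 0 := fun h => hG0 (by rw [hG1, h, mul_zero])
      have hH0 : H ≠ 0 := fun h => hG10 (by rw [hH, h, mul_zero])
      have hdH : H.natDegree ≤ 2 * n := by
        have e1 := natDegree_mul (X_sub_C_ne_zero α) hG10
        have e2 := natDegree_mul (X_sub_C_ne_zero γ) hH0
        rw [← hG1] at e1
        rw [← hH] at e2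
        rw [natDegree_X_sub_C] at e1 e2
        omega
      have hpos : ∀ z : ℂ, ‖z‖ = 1 → 0 < ‖z - α‖ ^ 2 := fun z hz => by
        have : z - α ≠ 0 := sub_ne_zero.2 fun h => hα1 (h ▸ hz)
        positivity
      -- On the circle `z - γ = -(conj α)⁻¹ z conj (z - α)`, so the two factors together contribute
      -- `|z - α|²` up to a constant and one factor `z`.
      obtain ⟨q, hq, hq'⟩ := ih (C (-(star α)⁻¹) * H) ((natDegree_C_mul_le _ _).trans hdH)
        (fun z => g z / ‖z - α‖ ^ 2) (fun z hz => ⟨div_pos (hg z hz).1 (hpos z hz), by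
          have h := (hg z hz).2
          rw [hG1, hH] at h
          simp only [eval_mul, eval_sub, eval_X, eval_C] at h ⊢
          have hz0 := ne_zero_of_norm_one hz
          have hzα : z - α ≠ 0 := sub_ne_zero.2 fun h => hα1 (h ▸ hz)
          have hsz : star (z - α) ≠ 0 := star_ne_zero.2 hzα
          push_cast
          have e : ((‖z - α‖ : ℂ)) ^ 2 = (z - α) * star (z - α) := by
            rw [mul_star_self_eq]; push_cast; rfl
          rw [e]
          have e2 : z - γ = -(star α)⁻¹ * z * star (z - α) := by
            rw [star_sub, star_eq_inv_of_norm_one hz, hγ]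
            field_simp
            ring
          rw [e2] at h
          rw [← mul_div_assoc, eq_div_iff (mul_ne_zero hzα hsz)]
          apply mul_left_cancel₀ hz0
          rw [← mul_assoc z (z ^ n), ← pow_succ', ← h]
          ring⟩)
      refine ⟨q * (X - C α), ?_, fun z hz => ?_⟩
      · refine natDegree_mul_le.trans ?_
        rw [natDegree_X_sub_C]; omega
      · rw [eval_mul, norm_mul, mul_pow, hq' z hz]
        simp only [eval_sub, eval_X, eval_C]
        exact div_mul_cancel₀ _ (hpos z hz).ne'

/-- `1 - |P|²` is a trigonometric polynomial, represented by `X^n - P · conjReflect n P`; the strict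
bound on `P` makes it positive, as Fejér–Riesz requires. -/
theorem exists_complementary {n : ℕ} {P : ℂ[X]} (hP : P.natDegree ≤ n)
    (h : ∀ z : ℂ, ‖z‖ = 1 → ‖P.eval z‖ < 1) :
    ∃ q : ℂ[X], q.natDegree ≤ n ∧
      ∀ z : ℂ, ‖z‖ = 1 → ‖P.eval z‖ ^ 2 + ‖q.eval z‖ ^ 2 = 1 := by
  obtain ⟨q, hq, hq'⟩ := fejer_riesz n (X ^ n - P * conjReflect n P) (by
    refine (natDegree_sub_le _ _).trans (max_le ?_ ?_)
    · rw [natDegree_X_pow]; omega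
    · refine natDegree_mul_le.trans ?_
      have := natDegree_conjReflect_le hP
      omega) (fun z => 1 - ‖P.eval z‖ ^ 2) (fun z hz => ⟨by
        have := h z hz
        nlinarith [norm_nonneg (P.eval z)], by
        simp only [eval_sub, eval_pow, eval_X, eval_mul, eval_conjReflect_circle hP hz]
        have := mul_star_self_eq (P.eval z)
        push_cast at this ⊢
        rw [← this]
        ring⟩)
  exact ⟨q, hq, fun z hz => by rw [hq' z hz]; ring⟩

/-! ### Decomposition into single-qubit rotations -/

/-- The pair of polynomials obtained from `(1, 0)` by alternating the multiplication of the second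
component by `X` with the given rotations; the head of the list acts last. -/
def rotationPolys : List (Matrix Bool Bool ℂ) → Bool → ℂ[X]
  | [] => fun c => if c then 0 else 1
  | R :: l => fun c =>
      C (R c false) * rotationPolys l false + C (R c true) * (X * rotationPolys l true)

/-- The unitary with columns `(a, b)` and `(-conj b, conj a)`. -/
def rotationMatrix (a b : ℂ) : Matrix Bool Bool ℂ :=
  Matrix.of fun c c' => if c' then (if c then star a else -star b) else (if c then b else a)

theorem rotationMatrix_mem {a b : ℂ} (h : ‖a‖ ^ 2 + ‖b‖ ^ 2 = 1) :
    rotationMatrix a b ∈ Matrix.unitaryGroup Bool ℂ := by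
  rw [Matrix.mem_unitaryGroup_iff']
  have ha := mul_star_self_eq a
  have hb := mul_star_self_eq b
  have h' : ((‖a‖ ^ 2 : ℝ) : ℂ) + ((‖b‖ ^ 2 : ℝ) : ℂ) = 1 := by exact_mod_cast h
  rw [← ha, ← hb] at h'
  change a * (starRingEnd ℂ) a + b * (starRingEnd ℂ) b = 1 at h'
  ext c c'
  cases c <;> cases c' <;>
    simp only [Matrix.mul_apply, Matrix.star_apply, rotationMatrix, Matrix.of_apply, Fintype.sum_bool,
      Matrix.one_apply] <;> simp <;> first | linear_combination h' | ring

theorem exists_normalized_pair {x y : ℂ} (h : ¬ (x = 0 ∧ y = 0)) :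
    ∃ (a b t : ℂ), ‖a‖ ^ 2 + ‖b‖ ^ 2 = 1 ∧ x = t * a ∧ y = t * b ∧ t ≠ 0 := by
  set r : ℝ := Real.sqrt (‖x‖ ^ 2 + ‖y‖ ^ 2) with hr
  have hpos : 0 < ‖x‖ ^ 2 + ‖y‖ ^ 2 := by
    by_cases hx : x = 0
    · have : y ≠ 0 := fun hy => h ⟨hx, hy⟩
      positivity
    · positivity
  have hr0 : 0 < r := Real.sqrt_pos.2 hpos
  have hrC : (r : ℂ) ≠ 0 := by exact_mod_cast hr0.ne'
  refine ⟨x / r, y / r, r, ?_, by field_simp, by field_simp, hrC⟩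
  rw [norm_div, norm_div, Complex.norm_real, Real.norm_of_nonneg hr0.le, div_pow, div_pow,
    ← add_div, hr, Real.sq_sqrt hpos.le, div_self hpos.ne']

/-- Orthogonality of `(x₀, y₀)` and `(x₁, y₁)` lets one rotation send them into different coordinate
axes. They will be the lowest and the highest coefficients of a complementary pair. -/
theorem exists_rotation {x₀ y₀ x₁ y₁ : ℂ} (h : x₀ * star x₁ + y₀ * star y₁ = 0) :
    ∃ a b : ℂ, ‖a‖ ^ 2 + ‖b‖ ^ 2 = 1 ∧ star a * x₁ + star b * y₁ = 0 ∧
      -b * x₀ + a * y₀ = 0 := by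
  have hs := congrArg star h
  simp only [star_add, star_mul', star_star, star_zero] at hs
  by_cases h0 : x₀ = 0 ∧ y₀ = 0
  · by_cases h1 : x₁ = 0 ∧ y₁ = 0
    · exact ⟨1, 0, by simp, by simp [h1.1], by simp [h0.2]⟩
    · obtain ⟨a, b, t, hab, rfl, rfl, -⟩ := exists_normalized_pair h1
      refine ⟨-star b, star a, by simpa [add_comm] using hab, ?_, by simp [h0.1, h0.2]⟩
      simp only [star_neg, star_star]; ring
  · obtain ⟨a, b, t, hab, rfl, rfl, ht⟩ := exists_normalized_pair h0
    refine ⟨a, b, hab, ?_, by ring⟩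
    simp only [star_mul'] at hs
    have : star t ≠ 0 := by simpa using ht
    apply mul_left_cancel₀ this
    linear_combination hs

/-- Layer stripping: undoing one rotation lowers the degree of the first polynomial and makes the
second divisible by `X`, which leaves a complementary pair of smaller degree. Degree `n` takes `n +
1` rotations, since the innermost multiplication by `X` acts on zero. -/
theorem exists_rotationPolys (n : ℕ) (P q : ℂ[X]) (hP : P.natDegree ≤ n) (hq : q.natDegree ≤ n)
    (h : ∀ z : ℂ, ‖z‖ = 1 → ‖P.eval z‖ ^ 2 + ‖q.eval z‖ ^ 2 = 1) :
    ∃ l : List (Matrix Bool Bool ℂ), l.length = n + 1 ∧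
      (∀ R ∈ l, R ∈ Matrix.unitaryGroup Bool ℂ) ∧
      rotationPolys l false = P ∧ rotationPolys l true = q := by
  induction n generalizing P q with
  | zero =>
    have h1 := eq_C_of_natDegree_le_zero hP
    have h2 := eq_C_of_natDegree_le_zero hq
    refine ⟨[rotationMatrix (P.coeff 0) (q.coeff 0)], rfl, ?_, ?_, ?_⟩
    · intro R hR
      rw [List.mem_singleton.1 hR]
      apply rotationMatrix_mem
      have := h 1 (by simp)
      rw [h1, h2] at this
      simpa using this
    · simp [rotationPolys, rotationMatrix, ← h1]
    · simp [rotationPolys, rotationMatrix, ← h2]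
  | succ n ih =>
    have hid : P * conjReflect (n + 1) P + q * conjReflect (n + 1) q = X ^ (n + 1) := by
      refine Polynomial.ext_of_circle fun z hz => ?_
      simp only [eval_add, eval_mul, eval_pow, eval_X, eval_conjReflect_circle hP hz,
        eval_conjReflect_circle hq hz]
      have h1 := mul_star_self_eq (P.eval z)
      have h2 := mul_star_self_eq (q.eval z)
      have h3 : ((‖P.eval z‖ ^ 2 : ℝ) : ℂ) + ((‖q.eval z‖ ^ 2 : ℝ) : ℂ) = 1 := by
        exact_mod_cast h z hz
      rw [← h1, ← h2] at h3
      linear_combination z ^ (n + 1) * h3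
    -- The constant coefficient of `hid`; its right side `X ^ (n + 1)` has none.
    have hc : P.coeff 0 * star (P.coeff (n + 1)) + q.coeff 0 * star (q.coeff (n + 1)) = 0 := by
      have := congrArg (fun p : ℂ[X] => p.coeff 0) hid
      simpa [mul_coeff_zero, coeff_conjReflect] using this
    obtain ⟨a, b, hab, htop, hbot⟩ := exists_rotation hc
    set P1 : ℂ[X] := C (star a) * P + C (star b) * q with hP1
    set q1 : ℂ[X] := C (-b) * P + C a * q with hq1
    have hab' : a * star a + b * star b = 1 := by
      rw [mul_star_self_eq, mul_star_self_eq]; exact_mod_cast hab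
    obtain ⟨q2, hq2⟩ : X ∣ q1 := X_dvd_iff.2 (by simpa [hq1] using hbot)
    have hP1d : P1.natDegree ≤ n := by
      rw [natDegree_le_iff_coeff_eq_zero]
      intro k hk
      rcases eq_or_ne k (n + 1) with rfl | hne
      · simpa [hP1] using htop
      · rw [hP1, coeff_add, coeff_C_mul, coeff_C_mul,
          coeff_eq_zero_of_natDegree_lt (by omega : P.natDegree < k),
          coeff_eq_zero_of_natDegree_lt (by omega : q.natDegree < k)]
        simp
    have hq2d : q2.natDegree ≤ n := by
      rw [natDegree_le_iff_coeff_eq_zero]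
      intro k hk
      have : q1.coeff (k + 1) = 0 := by
        rw [hq1, coeff_add, coeff_C_mul, coeff_C_mul,
          coeff_eq_zero_of_natDegree_lt (by omega : P.natDegree < k + 1),
          coeff_eq_zero_of_natDegree_lt (by omega : q.natDegree < k + 1)]
        simp
      rwa [hq2, coeff_X_mul] at this
    have hPe : P = C a * P1 + C (-star b) * q1 := by
      have e : (C a * C (star a) + C b * C (star b) : ℂ[X]) = 1 := by
        rw [← C_mul, ← C_mul, ← C_add, hab', C_1]
      rw [hP1, hq1]
      simp only [C_neg]
      linear_combination -P * e
    have hqe : q = C b * P1 + C (star a) * q1 := by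
      have e : (C a * C (star a) + C b * C (star b) : ℂ[X]) = 1 := by
        rw [← C_mul, ← C_mul, ← C_add, hab', C_1]
      rw [hP1, hq1]
      simp only [C_neg]
      linear_combination -q * e
    obtain ⟨l, hl, hlu, hl1, hl2⟩ := ih P1 q2 hP1d hq2d (fun z hz => by
      have key : ((‖P1.eval z‖ ^ 2 : ℝ) : ℂ) + ((‖q2.eval z‖ ^ 2 : ℝ) : ℂ) = 1 := by
        have hn : ‖q2.eval z‖ = ‖q1.eval z‖ := by
          rw [hq2, eval_mul, eval_X, norm_mul, hz, one_mul]
        have h3 : ((‖P.eval z‖ ^ 2 : ℝ) : ℂ) + ((‖q.eval z‖ ^ 2 : ℝ) : ℂ) = 1 := by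
          exact_mod_cast h z hz
        rw [hn, ← mul_star_self_eq, ← mul_star_self_eq]
        rw [← mul_star_self_eq, ← mul_star_self_eq] at h3
        simp only [hP1, hq1, eval_add, eval_mul, eval_C, star_add, star_mul', star_neg,
          star_star]
        linear_combination
          (eval z P * star (eval z P) + eval z q * star (eval z q)) * hab' + h3
      exact_mod_cast key)
    refine ⟨rotationMatrix a b :: l, by simp [hl], ?_, ?_, ?_⟩
    · intro R hR
      rcases List.mem_cons.1 hR with rfl | hR
      · exact rotationMatrix_mem hab
      · exact hlu R hR
    · rw [rotationPolys, hl1, hl2, ← hq2]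
      simpa [rotationMatrix] using hPe.symm
    · rw [rotationPolys, hl1, hl2, ← hq2]
      simpa [rotationMatrix] using hqe.symm

end CirclePolynomials

/-! ### A Jackson-type approximation of the square root on the circle. -/

noncomputable section Approximation

open Polynomial

/-- Parseval's identity on `N` equidistant points of the unit circle. -/
theorem sum_norm_sq_eval_roots {N : ℕ} (hN : 0 < N) {ζ : ℂ} (hζ : IsPrimitiveRoot ζ N)
    {h : ℂ[X]} (hdeg : h.natDegree < N) {z : ℂ} (hz : ‖z‖ = 1) :
    ∑ m ∈ Finset.range N, ‖h.eval (z * ζ ^ m)‖ ^ 2 =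
      N * ∑ t ∈ Finset.range N, ‖h.coeff t‖ ^ 2 := by
  have hζ1 : ‖ζ‖ = 1 := hζ.norm'_eq_one hN.ne'
  have hζ0 : ζ ≠ 0 := ne_zero_of_norm_one hζ1
  -- Exponents below `N` are distinct modulo `N`, so distinct monomials are orthogonal on the sample
  -- points and no aliasing occurs.
  have horth : ∀ t ∈ Finset.range N, ∀ s ∈ Finset.range N, t ≠ s →
      ∑ m ∈ Finset.range N, (ζ ^ m) ^ t * star ((ζ ^ m) ^ s) = 0 := by
    intro t ht s hs hts
    have e : ∀ m : ℕ, (ζ ^ m) ^ t * star ((ζ ^ m) ^ s) = (ζ ^ t * ζ⁻¹ ^ s) ^ m := by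
      intro m
      rw [star_pow, star_pow, star_eq_inv_of_norm_one hζ1, mul_pow, ← pow_mul, ← pow_mul,
        ← pow_mul, ← pow_mul, mul_comm m t, mul_comm m s]
    simp only [e]
    have hne : ζ ^ t * ζ⁻¹ ^ s ≠ 1 := by
      intro h1
      apply hts
      apply hζ.pow_inj (Finset.mem_range.1 ht) (Finset.mem_range.1 hs)
      rw [inv_pow] at h1
      exact (mul_inv_eq_one₀ (pow_ne_zero s hζ0)).1 h1
    rw [geom_sum_eq hne, mul_pow, ← pow_mul, ← pow_mul, mul_comm t, mul_comm s, pow_mul,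
      pow_mul, inv_pow, hζ.pow_eq_one]
    simp
  have hC : (∑ m ∈ Finset.range N, ((‖h.eval (z * ζ ^ m)‖ ^ 2 : ℝ) : ℂ)) =
      N * ∑ t ∈ Finset.range N, ((‖h.coeff t‖ ^ 2 : ℝ) : ℂ) := by
    simp only [← mul_star_self_eq, eval_eq_sum_range' hdeg, star_sum, Finset.sum_mul_sum]
    rw [Finset.sum_comm, Finset.mul_sum]
    refine Finset.sum_congr rfl fun t ht => ?_
    rw [Finset.sum_comm, Finset.sum_eq_single_of_mem t ht]
    · have hz' : ∀ m : ℕ, (z * ζ ^ m) ^ t * star ((z * ζ ^ m) ^ t) = 1 := by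
        intro m
        rw [mul_star_self_eq, norm_pow, norm_mul, norm_pow, hz, hζ1]; simp
      simp only [star_mul']
      calc _ = ∑ m ∈ Finset.range N, h.coeff t * star (h.coeff t) *
            ((z * ζ ^ m) ^ t * star ((z * ζ ^ m) ^ t)) :=
            Finset.sum_congr rfl fun m _ => by simp only [star_pow, star_mul']; ring
        _ = _ := by simp only [hz', mul_one, Finset.sum_const, Finset.card_range, nsmul_eq_mul]
    · intro s hs hst
      calc _ = ∑ m ∈ Finset.range N, h.coeff t * star (h.coeff s) * z ^ t * star (z ^ s) *
            ((ζ ^ m) ^ t * star ((ζ ^ m) ^ s)) :=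
            Finset.sum_congr rfl fun m _ => by
              simp only [star_pow, star_mul', mul_pow]; ring
        _ = 0 := by rw [← Finset.mul_sum, horth t ht s hs hst.symm, mul_zero]
  exact_mod_cast hC

/-- Selects the branch of the square root on the right half plane, where the eigenphases `exp (± i
θ)` with `cos θ > 0` lie. -/
theorem exists_sqrt_re_nonneg (ζ : ℂ) : ∃ f : ℂ, f ^ 2 = ζ ∧ 0 ≤ f.re := by
  obtain ⟨f, hf⟩ := IsSquare.exists_sq ζ (by
    obtain ⟨w, hw⟩ := IsAlgClosed.exists_pow_nat_eq ζ (n := 2) (by norm_num)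
    exact ⟨w, by rw [← hw, sq]⟩)
  rcases le_total 0 f.re with h | h
  · exact ⟨f, hf.symm, h⟩
  · exact ⟨-f, by rw [neg_sq, hf], by simpa using h⟩

/-- The polynomial `1 + X + ⋯ + X^(L-1)`. -/
def geomPoly (L : ℕ) : ℂ[X] := ∑ t ∈ Finset.range L, X ^ t

theorem coeff_geomPoly (L t : ℕ) : (geomPoly L).coeff t = if t < L then 1 else 0 := by
  simp [geomPoly, coeff_X_pow]

theorem natDegree_geomPoly_le (L : ℕ) : (geomPoly L).natDegree ≤ L - 1 := by
  rw [natDegree_le_iff_coeff_eq_zero]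
  intro k hk
  rw [coeff_geomPoly, if_neg (by omega)]

theorem geomPoly_mul (L : ℕ) : geomPoly L * (1 - X) = 1 - X ^ L := by
  rw [geomPoly, ← neg_sub X, mul_neg, geom_sum_mul]; ring

theorem eval_geomPoly_palindromic (L : ℕ) {y : ℂ} (hy : ‖y‖ = 1) :
    y ^ (L - 1) * star ((geomPoly L).eval y) = (geomPoly L).eval y := by
  simp only [geomPoly, eval_finsetSum, eval_pow, eval_X, star_sum, star_pow, Finset.mul_sum]
  rw [← Finset.sum_range_reflect (fun t => y ^ t)]
  refine Finset.sum_congr rfl fun t ht => ?_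
  have ht' := Finset.mem_range.1 ht
  rw [star_eq_inv_of_norm_one hy]
  have : y ^ (L - 1) = y ^ (L - 1 - t) * y ^ t := by rw [← pow_add]; congr 1; omega
  rw [this, mul_assoc, ← mul_pow, mul_inv_cancel₀ (ne_zero_of_norm_one hy), one_pow, mul_one]

/-- On the unit circle the fourth power of the geometric polynomial is a nonnegative kernel, up to
a monomial. -/
theorem eval_geomPoly_pow_four (L : ℕ) {y : ℂ} (hy : ‖y‖ = 1) :
    (geomPoly L).eval y ^ 4 =
      y ^ (2 * (L - 1)) * ((‖(geomPoly L ^ 2).eval y‖ ^ 2 : ℝ) : ℂ) := by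
  have h := eval_geomPoly_palindromic L hy
  rw [← mul_star_self_eq, eval_pow, star_pow]
  set g := (geomPoly L).eval y
  calc g ^ 4 = g ^ 2 * g ^ 2 := by ring
    _ = g ^ 2 * (y ^ (L - 1) * star g) ^ 2 := by rw [h]
    _ = _ := by rw [mul_pow, ← pow_mul, mul_comm (L - 1) 2]; ring

/-- Cauchy–Schwarz: the at most `2 L` coefficients add up to the value `L²` at `1`. This bounds the
total mass of the kernel below. -/
theorem geomPoly_sq_mass {L : ℕ} (hL : 1 ≤ L) :
    (L : ℝ) ^ 3 ≤ 2 * ∑ t ∈ Finset.range (2 * L), ‖(geomPoly L ^ 2).coeff t‖ ^ 2 := by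
  have hdeg : (geomPoly L ^ 2).natDegree < 2 * L := by
    have := natDegree_pow_le (p := geomPoly L) (n := 2)
    have := natDegree_geomPoly_le L
    omega
  have h1 : ((L : ℝ)) ^ 2 ≤ ∑ t ∈ Finset.range (2 * L), ‖(geomPoly L ^ 2).coeff t‖ := by
    have e : (geomPoly L ^ 2).eval 1 = (L : ℂ) ^ 2 := by simp [geomPoly, eval_finsetSum]
    rw [eval_eq_sum_range' hdeg] at e
    have := congrArg norm e
    rw [norm_pow, Complex.norm_natCast] at this
    rw [← this]
    refine (norm_sum_le _ _).trans (Finset.sum_le_sum fun t _ => ?_)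
    simp
  have h2 := sq_sum_le_card_mul_sum_sq (s := Finset.range (2 * L))
    (f := fun t => ‖(geomPoly L ^ 2).coeff t‖)
  rw [Finset.card_range] at h2
  set S := ∑ t ∈ Finset.range (2 * L), ‖(geomPoly L ^ 2).coeff t‖ ^ 2
  have hL' : (0 : ℝ) < L := by exact_mod_cast hL
  have h3 : ((L : ℝ) ^ 2) ^ 2 ≤ (2 * L) * S := by
    refine (pow_le_pow_left₀ (by positivity) h1 2).trans ?_
    exact_mod_cast h2
  have : (L : ℝ) * (L : ℝ) ^ 3 ≤ L * (2 * S) := by nlinarith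
  exact le_of_mul_le_mul_left this hL'

/-- Multiplication by `1 - X` telescopes one geometric factor and leaves coefficients `0` and `±1`.
By Parseval this controls the second moment of the kernel about `1`. -/
theorem geomPoly_sq_diff {L : ℕ} :
    ∑ t ∈ Finset.range (2 * L), ‖((1 - X) * geomPoly L ^ 2).coeff t‖ ^ 2 ≤ 2 * L := by
  have e : (1 - X) * geomPoly L ^ 2 = geomPoly L - geomPoly L * X ^ L := by
    rw [sq, ← mul_assoc, mul_comm (1 - X), geomPoly_mul]; ring
  rw [e]
  have : ∀ t ∈ Finset.range (2 * L),
      ‖(geomPoly L - geomPoly L * X ^ L).coeff t‖ ^ 2 ≤ 1 := by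
    intro t _
    rw [coeff_sub, coeff_mul_X_pow', coeff_geomPoly, coeff_geomPoly]
    by_cases h : t < L
    · rw [if_pos h, if_neg (by omega)]; simp
    · rw [if_neg h]
      split_ifs <;> simp
  refine (Finset.sum_le_card_nsmul _ _ 1 this).trans ?_
  simp

/-- A polynomial of degree `4 (L - 1)`, bounded by one on the unit circle, that approximates
`b² ↦ b^(4 (L - 1) + 1)` for `b` on the right half of the unit circle. -/
theorem exists_half_power_polynomial {L : ℕ} (hL : 1 ≤ L) :
    ∃ P : ℂ[X], P.natDegree ≤ 4 * (L - 1) ∧ (∀ z : ℂ, ‖z‖ = 1 → ‖P.eval z‖ < 1) ∧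
      ∀ b : ℂ, ‖b‖ = 1 → 0 < b.re →
        1 - (P.eval (b ^ 2) * star b ^ (4 * (L - 1) + 1)).re ≤ 3 / (L ^ 2 * b.re ^ 2) := by
  set N := 2 * L with hN
  have hN0 : 0 < N := by omega
  have hLr : (1 : ℝ) ≤ L := by exact_mod_cast hL
  set ζ : ℂ := Complex.exp (2 * Real.pi * Complex.I / (N : ℂ))
  have hζ : IsPrimitiveRoot ζ N := Complex.isPrimitiveRoot_exp N hN0.ne'
  have hζ1 : ‖ζ‖ = 1 := hζ.norm'_eq_one hN0.ne'
  have hζm : ∀ m : ℕ, ‖ζ ^ m‖ = 1 := fun m => by rw [norm_pow, hζ1, one_pow]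
  choose f hf hfre using fun m : ℕ => exists_sqrt_re_nonneg (star (ζ ^ m))
  have hf1 : ∀ m, ‖f m‖ = 1 := fun m => by
    have : ‖f m‖ ^ 2 = 1 := by rw [← norm_pow, hf, norm_star, hζm]
    nlinarith [norm_nonneg (f m)]
  obtain ⟨c, hc⟩ : ∃ c : ℝ, c = ∑ t ∈ Finset.range N, ‖(geomPoly L ^ 2).coeff t‖ ^ 2 := ⟨_, rfl⟩
  have hmass := geomPoly_sq_mass hL
  rw [← hN, ← hc] at hmass
  have hcpos : 0 < c := by
    have : (0 : ℝ) < (L : ℝ) ^ 3 := by positivity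
    linarith
  have hNr : (0 : ℝ) < N := by exact_mod_cast hN0
  have hdeg : (geomPoly L ^ 2).natDegree < N := by
    have := natDegree_pow_le (p := geomPoly L) (n := 2)
    have := natDegree_geomPoly_le L
    omega
  have hdeg2 : ((1 - X) * geomPoly L ^ 2).natDegree < N := by
    have h1 := natDegree_mul_le (p := (1 - X : ℂ[X])) (q := geomPoly L ^ 2)
    have h2 : (1 - X : ℂ[X]).natDegree ≤ 1 := by
      refine (natDegree_sub_le _ _).trans (by simp)
    have h3 := natDegree_pow_le (p := geomPoly L) (n := 2)
    have h4 := natDegree_geomPoly_le L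
    omega
  -- The squared Fejér kernel, normalised to total weight one over the `N` nodes; it concentrates
  -- where `star (ζ ^ m)` is near `z`.
  let w : ℂ → ℕ → ℝ := fun z m => (N * c)⁻¹ * ‖(geomPoly L ^ 2).eval (z * ζ ^ m)‖ ^ 2
  have hw0 : ∀ z m, 0 ≤ w z m := fun z m => by positivity
  have hw1 : ∀ z : ℂ, ‖z‖ = 1 → ∑ m ∈ Finset.range N, w z m = 1 := fun z hz => by
    simp only [w]
    rw [← Finset.mul_sum, sum_norm_sq_eval_roots hN0 hζ hdeg hz, ← hc]
    field_simp
  -- The second moment is the ratio of `geomPoly_sq_diff` to `geomPoly_sq_mass`: `2 L` against `L³ /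
  -- 2`.
  have hw2 : ∀ z : ℂ, ‖z‖ = 1 →
      ∑ m ∈ Finset.range N, w z m * ‖star (ζ ^ m) - z‖ ^ 2 ≤ 4 / L ^ 2 := fun z hz => by
    have e : ∀ m, w z m * ‖star (ζ ^ m) - z‖ ^ 2 =
        (N * c)⁻¹ * ‖((1 - X) * geomPoly L ^ 2).eval (z * ζ ^ m)‖ ^ 2 := fun m => by
      have : ‖star (ζ ^ m) - z‖ = ‖1 - z * ζ ^ m‖ := by
        have h1 : star (ζ ^ m) - z = star (ζ ^ m) * (1 - z * ζ ^ m) := by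
          have := mul_star_self_eq (ζ ^ m)
          rw [hζm] at this
          push_cast at this
          linear_combination z * this
        rw [h1, norm_mul, norm_star, hζm, one_mul]
      rw [this, eval_mul, norm_mul]
      simp only [w, eval_sub, eval_one, eval_X]
      ring
    simp only [e]
    rw [← Finset.mul_sum, sum_norm_sq_eval_roots hN0 hζ hdeg2 hz, mul_inv, mul_mul_mul_comm,
      inv_mul_cancel₀ hNr.ne', one_mul, inv_mul_eq_div, div_le_div_iff₀ hcpos (by positivity)]
    have := geomPoly_sq_diff (L := L)
    have h2 : (∑ t ∈ Finset.range N, ‖((1 - X) * geomPoly L ^ 2).coeff t‖ ^ 2) * (L : ℝ) ^ 2 ≤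
        (2 * L) * (L : ℝ) ^ 2 := by gcongr
    nlinarith
  -- Shrinking by `1 - η` makes the bound by one strict, at a cost no larger than the order of the
  -- approximation error.
  set η : ℝ := 1 / L ^ 2 with hη
  have hη0 : 0 < η := by positivity
  have hη1 : η ≤ 1 := by
    rw [hη, div_le_one (by positivity)]; nlinarith
  -- The weighted mean of the square roots `f m`, written with the fourth power of `geomPoly`. The
  -- power of `star (ζ ^ m)` cancels the node phase of `eval_geomPoly_pow_four` and leaves `z ^ (2 *
  -- (L - 1))`.
  set P : ℂ[X] := ∑ m ∈ Finset.range N,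
    C (((1 - η) * (N * c)⁻¹ : ℝ) * f m * star (ζ ^ m) ^ (2 * (L - 1))) *
      (geomPoly L).comp (C (ζ ^ m) * X) ^ 4 with hP
  have hPev : ∀ z : ℂ, ‖z‖ = 1 → P.eval z =
      (1 - η : ℝ) * z ^ (2 * (L - 1)) * ∑ m ∈ Finset.range N, (w z m : ℂ) * f m := fun z hz => by
    rw [hP, eval_finsetSum, Finset.mul_sum]
    apply Finset.sum_congr rfl
    intro m _
    have hy : ‖ζ ^ m * z‖ = 1 := by rw [norm_mul, hζm, hz, one_mul]
    simp only [eval_mul, eval_C, eval_pow, eval_comp, eval_X]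
    rw [eval_geomPoly_pow_four L hy, mul_pow]
    have h1 : star (ζ ^ m) ^ (2 * (L - 1)) * (ζ ^ m) ^ (2 * (L - 1)) = 1 := by
      rw [← mul_pow, mul_comm, mul_star_self_eq, hζm]; simp
    simp only [w]
    rw [mul_comm z]
    push_cast
    linear_combination (1 - (η : ℂ)) * ((N : ℂ) * c)⁻¹ * f m * z ^ (2 * (L - 1)) *
      (‖eval (ζ ^ m * z) (geomPoly L ^ 2)‖ : ℂ) ^ 2 * h1
  have hbound : ∀ z : ℂ, ‖z‖ = 1 → ‖∑ m ∈ Finset.range N, (w z m : ℂ) * f m‖ ≤ 1 := fun z hz => by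
    refine (norm_sum_le _ _).trans (le_of_eq ?_)
    rw [← hw1 z hz]
    refine Finset.sum_congr rfl fun m _ => ?_
    rw [norm_mul, hf1, mul_one, Complex.norm_real, Real.norm_of_nonneg (hw0 z m)]
  refine ⟨P, ?_, fun z hz => ?_, fun b hb hbre => ?_⟩
  · refine natDegree_sum_le_of_forall_le _ _ fun m _ => ?_
    refine (natDegree_C_mul_le _ _).trans (natDegree_pow_le.trans ?_)
    have h1 := natDegree_comp_le (p := geomPoly L) (q := C (ζ ^ m) * X)
    have h2 : (C (ζ ^ m) * X).natDegree ≤ 1 := (natDegree_C_mul_le _ _).trans natDegree_X_le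
    have h3 := natDegree_geomPoly_le L
    nlinarith
  · rw [hPev z hz, norm_mul, norm_mul, norm_pow, hz, one_pow, mul_one, Complex.norm_real,
      Real.norm_of_nonneg (by linarith)]
    have := hbound z hz
    nlinarith [norm_nonneg (∑ m ∈ Finset.range N, (w z m : ℂ) * f m)]
  · have hz : ‖b ^ 2‖ = 1 := by rw [norm_pow, hb, one_pow]
    have e : P.eval (b ^ 2) * star b ^ (4 * (L - 1) + 1) =
        (1 - η : ℝ) * ∑ m ∈ Finset.range N, (w (b ^ 2) m : ℂ) * (f m * star b) := by
      rw [hPev _ hz, ← pow_mul, pow_succ (star b)]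
      have h1 : b ^ (2 * (2 * (L - 1))) * star b ^ (4 * (L - 1)) = 1 := by
        have : 2 * (2 * (L - 1)) = 4 * (L - 1) := by ring
        rw [this, ← mul_pow, mul_star_self_eq, hb]; simp
      simp only [← mul_assoc]
      rw [← Finset.sum_mul]
      linear_combination (1 - η : ℝ) * (∑ m ∈ Finset.range N, (w (b ^ 2) m : ℂ) * f m) *
        star b * h1
    have hre : (P.eval (b ^ 2) * star b ^ (4 * (L - 1) + 1)).re =
        (1 - η) * ∑ m ∈ Finset.range N, w (b ^ 2) m * (f m * star b).re := by
      rw [e, Complex.re_ofReal_mul, Complex.re_sum]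
      simp only [Complex.re_ofReal_mul]
    -- For unit vectors `1 - Re (f conj b) = |f - b|² / 2`, and `f² - b² = (f - b)(f + b)` with `|f
    -- + b| ≥ Re b` because both lie in the right half plane.
    have hpt : ∀ m, 1 - (f m * star b).re ≤ ‖star (ζ ^ m) - b ^ 2‖ ^ 2 / (2 * b.re ^ 2) := by
      intro m
      have h1 : ‖f m - b‖ ^ 2 = 2 * (1 - (f m * star b).re) := by
        have a1 : (f m).re ^ 2 + (f m).im ^ 2 = 1 := by
          have := hf1 m
          have h2 := Complex.sq_norm (f m)
          rw [this, Complex.normSq_apply] at h2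
          linarith
        have a2 : b.re ^ 2 + b.im ^ 2 = 1 := by
          have h2 := Complex.sq_norm b
          rw [hb, Complex.normSq_apply] at h2
          linarith
        rw [Complex.sq_norm, Complex.normSq_apply]
        simp
        nlinarith
      have h2 : ‖star (ζ ^ m) - b ^ 2‖ = ‖f m - b‖ * ‖f m + b‖ := by
        rw [← hf, ← norm_mul]; congr 1; ring
      have h3 : b.re ≤ ‖f m + b‖ := by
        refine le_trans ?_ (Complex.re_le_norm _)
        rw [Complex.add_re]; linarith [hfre m]
      rw [le_div_iff₀ (by positivity), h2, mul_pow, h1]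
      have h4 : b.re ^ 2 ≤ ‖f m + b‖ ^ 2 := pow_le_pow_left₀ hbre.le h3 2
      have h5 : 0 ≤ 1 - (f m * star b).re := by
        have := sq_nonneg ‖f m - b‖
        linarith
      nlinarith
    have hsum : 1 - ∑ m ∈ Finset.range N, w (b ^ 2) m * (f m * star b).re ≤
        2 / (L ^ 2 * b.re ^ 2) := by
      calc 1 - ∑ m ∈ Finset.range N, w (b ^ 2) m * (f m * star b).re
          = ∑ m ∈ Finset.range N, w (b ^ 2) m * (1 - (f m * star b).re) := by
            simp only [mul_sub, mul_one, Finset.sum_sub_distrib, hw1 _ hz]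
        _ ≤ ∑ m ∈ Finset.range N, w (b ^ 2) m * (‖star (ζ ^ m) - b ^ 2‖ ^ 2 / (2 * b.re ^ 2)) :=
            Finset.sum_le_sum fun m _ => mul_le_mul_of_nonneg_left (hpt m) (hw0 _ m)
        _ = (∑ m ∈ Finset.range N, w (b ^ 2) m * ‖star (ζ ^ m) - b ^ 2‖ ^ 2) /
              (2 * b.re ^ 2) := by
            rw [Finset.sum_div]
            exact Finset.sum_congr rfl fun m _ => by ring
        _ ≤ (4 / L ^ 2) / (2 * b.re ^ 2) := by gcongr; exact hw2 _ hz
        _ = 2 / (L ^ 2 * b.re ^ 2) := by field_simp; norm_num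
    rw [hre]
    set S := ∑ m ∈ Finset.range N, w (b ^ 2) m * (f m * star b).re
    have hS : S ≤ 1 := by
      rw [← hw1 _ hz]
      refine Finset.sum_le_sum fun m _ => mul_le_of_le_one_right (hw0 _ m) ?_
      refine (Complex.re_le_norm _).trans ?_
      rw [norm_mul, norm_star, hf1, hb, one_mul]
    have hb1 : b.re ≤ 1 := hb ▸ Complex.re_le_norm b
    have hηb : η ≤ 1 / (L ^ 2 * b.re ^ 2) := by
      rw [hη]
      apply one_div_le_one_div_of_le (by positivity)
      nlinarith [mul_le_mul hb1 hb1 hbre.le zero_le_one, sq_nonneg (L : ℝ)]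
    have h3 : (3 : ℝ) / (L ^ 2 * b.re ^ 2) = 2 / (L ^ 2 * b.re ^ 2) + 1 / (L ^ 2 * b.re ^ 2) := by
      rw [← add_div]; norm_num
    rw [h3]
    nlinarith

end Approximation

/-! ### Gates, reversible programs and reflections as circuits. -/

noncomputable section Circuits

/-! ### Gates acting on states -/

theorem extend_comp_self {κ ω : Type*} (e : κ ↪ ω) (x : ω → Bool) :
    Function.extend e (x ∘ e) x = x := by
  funext w
  by_cases h : ∃ k, e k = w
  · obtain ⟨k, rfl⟩ := h
    rw [e.injective.extend_apply]; rfl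
  · rw [Function.extend_apply' _ _ _ h]

section Gates

variable {κ ω δ : Type*} [Fintype κ] [DecidableEq κ] [Fintype ω] [DecidableEq ω]
  [Fintype δ] [DecidableEq δ]

theorem actOn_mulVec_apply (e : κ ↪ ω) (G : Matrix (κ → Bool) (κ → Bool) ℂ)
    (ψ : (ω → Bool) → ℂ) (x : ω → Bool) :
    (actOn e G *ᵥ ψ) x = ∑ y : κ → Bool, G (x ∘ e) y * ψ (Function.extend e y x) := by
  rw [Matrix.mulVec, dotProduct]
  symm
  refine Fintype.sum_of_injective (fun y => Function.extend e y x) ?_ _ _ ?_ ?_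
  · intro y y' h
    funext k
    have := congrFun h (e k)
    simpa [e.injective.extend_apply] using this
  · intro z hz
    rw [actOn, Matrix.of_apply, if_neg, zero_mul]
    intro h
    apply hz
    refine ⟨z ∘ e, ?_⟩
    funext w
    by_cases hw : ∃ k, e k = w
    · obtain ⟨k, rfl⟩ := hw
      simp [e.injective.extend_apply]
    · simp only [Function.extend_apply' _ _ _ hw]
      exact h w hw
  · intro y
    have h1 : Function.extend e y x ∘ e = y := by
      funext k; simp [e.injective.extend_apply]
    rw [actOn, Matrix.of_apply, if_pos, h1]
    intro w hw
    rw [Function.extend_apply' _ _ _ hw]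

/-- The matrix of the classical map `π` read as `ψ ↦ ψ ∘ π`. -/
def pullbackMatrix {ι : Type*} [DecidableEq ι] (π : ι → ι) : Matrix ι ι ℂ :=
  Matrix.of fun a b => if b = π a then 1 else 0

theorem pullbackMatrix_mem {ι : Type*} [Fintype ι] [DecidableEq ι] {π : ι → ι}
    (h : Function.Involutive π) : pullbackMatrix π ∈ Matrix.unitaryGroup ι ℂ := by
  rw [Matrix.mem_unitaryGroup_iff]
  ext a b
  rw [Matrix.mul_apply, Matrix.one_apply]
  simp only [pullbackMatrix, Matrix.star_apply, Matrix.of_apply, ite_mul, one_mul, zero_mul,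
    Finset.sum_ite_eq', Finset.mem_univ, if_true]
  by_cases hab : a = b
  · simp [hab]
  · rw [if_neg, if_neg hab, star_zero]
    exact fun h' => hab (h.injective h')

theorem actOn_pullbackMatrix (e : κ ↪ ω) (π : (κ → Bool) → (κ → Bool)) (ψ : (ω → Bool) → ℂ)
    (x : ω → Bool) :
    (actOn e (pullbackMatrix π) *ᵥ ψ) x = ψ (Function.extend e (π (x ∘ e)) x) := by
  rw [actOn_mulVec_apply]
  simp [pullbackMatrix]

/-- The diagonal matrix of signs given by a predicate. -/
def signMatrix {ι : Type*} [DecidableEq ι] (h : ι → Bool) : Matrix ι ι ℂ :=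
  Matrix.diagonal fun a => if h a then -1 else 1

theorem signMatrix_mem {ι : Type*} [Fintype ι] [DecidableEq ι] (h : ι → Bool) :
    signMatrix h ∈ Matrix.unitaryGroup ι ℂ := by
  rw [Matrix.mem_unitaryGroup_iff, signMatrix, Matrix.star_eq_conjTranspose,
    Matrix.diagonal_conjTranspose, Matrix.diagonal_mul_diagonal, ← Matrix.diagonal_one]
  congr 1
  funext a
  by_cases ha : h a <;> simp [ha]

theorem actOn_signMatrix (e : κ ↪ ω) (h : (κ → Bool) → Bool) (ψ : (ω → Bool) → ℂ)
    (x : ω → Bool) :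
    (actOn e (signMatrix h) *ᵥ ψ) x = (if h (x ∘ e) then -1 else 1) * ψ x := by
  rw [actOn_mulVec_apply, Finset.sum_eq_single (x ∘ e)]
  · rw [signMatrix, Matrix.diagonal_apply_eq, extend_comp_self]
  · intro y _ hy
    rw [signMatrix, Matrix.diagonal_apply_ne _ hy.symm, zero_mul]
  · simp

/-- A single-qubit gate. -/
def qubitGate (R : Matrix Bool Bool ℂ) : Matrix (Fin 1 → Bool) (Fin 1 → Bool) ℂ :=
  R.submatrix (Equiv.funUnique (Fin 1) Bool) (Equiv.funUnique (Fin 1) Bool)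

theorem qubitGate_mem {R : Matrix Bool Bool ℂ} (h : R ∈ Matrix.unitaryGroup Bool ℂ) :
    qubitGate R ∈ Matrix.unitaryGroup (Fin 1 → Bool) ℂ := by
  rw [Matrix.mem_unitaryGroup_iff] at h ⊢
  rw [qubitGate, Matrix.star_eq_conjTranspose, Matrix.conjTranspose_submatrix,
    Matrix.submatrix_mul_equiv, ← Matrix.star_eq_conjTranspose, h, Matrix.submatrix_one_equiv]

/-- The state of the data qubits and of the control qubit (the first ancilla) given by the pair
`Ψ`, all further ancillas being in state zero. -/
def controlledState {n : ℕ} (Ψ : Bool → (δ → Bool) → ℂ) :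
    (δ ⊕ Fin (n + 1) → Bool) → ℂ :=
  fun x => if ∀ t : Fin n, x (Sum.inr t.succ) = false then
    Ψ (x (Sum.inr 0)) (x ∘ Sum.inl) else 0

theorem actOn_inl_controlledState {n : ℕ} (V : Matrix (δ → Bool) (δ → Bool) ℂ)
    (Ψ : Bool → (δ → Bool) → ℂ) :
    actOn (Function.Embedding.inl : δ ↪ δ ⊕ Fin (n + 1)) V *ᵥ controlledState Ψ =
      controlledState fun c => V *ᵥ Ψ c := by
  funext x
  rw [actOn_mulVec_apply]
  have h1 : ∀ (y : δ → Bool) (t : Fin (n + 1)),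
      Function.extend (Function.Embedding.inl : δ ↪ δ ⊕ Fin (n + 1)) y x (Sum.inr t) =
        x (Sum.inr t) := fun y t => Function.extend_apply' _ _ _ (by rintro ⟨k, hk⟩; cases hk)
  have h2 : ∀ y : δ → Bool,
      Function.extend (Function.Embedding.inl : δ ↪ δ ⊕ Fin (n + 1)) y x ∘ Sum.inl = y :=
    fun y => funext fun k => (Function.Embedding.inl :
      δ ↪ δ ⊕ Fin (n + 1)).injective.extend_apply y x k
  simp only [controlledState, h1, h2]
  split_ifs
  · rfl
  · simp

/-- The embedding of the control qubit. -/
def controlQubit (δ : Type*) (n : ℕ) : Fin 1 ↪ δ ⊕ Fin (n + 1) :=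
  ⟨fun _ => Sum.inr 0, fun _ _ _ => Subsingleton.elim _ _⟩

theorem actOn_controlQubit (R : Matrix Bool Bool ℂ) {n : ℕ} (Ψ : Bool → (δ → Bool) → ℂ) :
    actOn (controlQubit δ n) (qubitGate R) *ᵥ controlledState Ψ =
      controlledState fun c => R c false • Ψ false + R c true • Ψ true := by
  funext x
  rw [actOn_mulVec_apply, ← (Equiv.funUnique (Fin 1) Bool).symm.sum_comp]
  have h0 : ∀ y : Fin 1 → Bool,
      Function.extend (controlQubit δ n) y x (Sum.inr 0) = y 0 := fun y =>
    (controlQubit δ n).injective.extend_apply y x 0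
  have h1 : ∀ (y : Fin 1 → Bool) (t : Fin n),
      Function.extend (controlQubit δ n) y x (Sum.inr t.succ) = x (Sum.inr t.succ) := fun y t =>
    Function.extend_apply' _ _ _ (by
      rintro ⟨k, hk⟩
      exact Fin.succ_ne_zero t (Sum.inr.inj hk).symm)
  have h2 : ∀ y : Fin 1 → Bool,
      Function.extend (controlQubit δ n) y x ∘ Sum.inl = x ∘ Sum.inl := fun y =>
    funext fun k => Function.extend_apply' _ _ _ (by rintro ⟨k, hk⟩; cases hk)
  simp only [controlledState, h0, h1, h2, Fintype.sum_bool]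
  split_ifs
  · simp [qubitGate, controlQubit, add_comm]
    rfl
  · simp

end Gates

/-! ### Classical reversible programs -/

/-- The map that adds `g` of the first two bits to the third one. -/
def xorMap (g : Bool → Bool → Bool) (a : Fin 3 → Bool) : Fin 3 → Bool :=
  Function.update a 2 (xor (a 2) (g (a 0) (a 1)))

theorem xorMap_involutive (g : Bool → Bool → Bool) : Function.Involutive (xorMap g) := by
  intro a
  funext k
  fin_cases k <;> simp [xorMap]

/-- An instruction: add `g` of the first two selected bits to the third one. -/
abbrev Instruction (ω : Type) : Type := (Bool → Bool → Bool) × (Fin 3 ↪ ω)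

def Instruction.run {ω : Type} (i : Instruction ω) (x : ω → Bool) : ω → Bool :=
  Function.extend i.2 (xorMap i.1 (x ∘ i.2)) x

theorem Instruction.run_apply_of_ne {ω : Type} (i : Instruction ω) (x : ω → Bool) {w : ω}
    (hw : w ≠ i.2 2) : i.run x w = x w := by
  rw [Instruction.run]
  by_cases h : ∃ k, i.2 k = w
  · obtain ⟨k, rfl⟩ := h
    have hk : k ≠ 2 := fun h => hw (by rw [h])
    rw [i.2.injective.extend_apply, xorMap, Function.update_of_ne hk]
    rfl
  · rw [Function.extend_apply' _ _ _ h]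

theorem Instruction.run_target {ω : Type} (i : Instruction ω) (x : ω → Bool) :
    i.run x (i.2 2) = xor (x (i.2 2)) (i.1 (x (i.2 0)) (x (i.2 1))) := by
  rw [Instruction.run, i.2.injective.extend_apply, xorMap, Function.update_self]
  rfl

theorem Instruction.run_involutive {ω : Type} (i : Instruction ω) :
    Function.Involutive i.run := by
  intro x
  funext w
  by_cases hw : w = i.2 2
  · subst hw
    have h0 : i.2 0 ≠ i.2 2 := fun h => by simpa using i.2.injective h
    have h1 : i.2 1 ≠ i.2 2 := fun h => by simpa using i.2.injective h
    rw [run_target, run_target, run_apply_of_ne _ _ h0, run_apply_of_ne _ _ h1]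
    simp
  · rw [run_apply_of_ne _ _ hw, run_apply_of_ne _ _ hw]

/-- Execution of a program. -/
def runProgram {ω : Type} : List (Instruction ω) → (ω → Bool) → (ω → Bool)
  | [], x => x
  | i :: l, x => runProgram l (i.run x)

theorem runProgram_append {ω : Type} (l l' : List (Instruction ω)) (x : ω → Bool) :
    runProgram (l ++ l') x = runProgram l' (runProgram l x) := by
  induction l generalizing x with
  | nil => rfl
  | cons i l ih => exact ih _

section Program

variable {Q M : ℕ}

theorem circuitOp_append {a : ℕ} (UM UN : Matrix.unitaryGroup (DataQubit Q M → Bool) ℂ)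
    (c c' : Circuit Q M a) :
    circuitOp UM UN (c ++ c') = circuitOp UM UN c' * circuitOp UM UN c := by
  induction c with
  | nil => simp [circuitOp]
  | cons s c ih => rw [List.cons_append, circuitOp, circuitOp, ih, mul_assoc]

theorem circuitTime_append {a : ℕ} (τ : ℝ) (c c' : Circuit Q M a) :
    circuitTime τ (c ++ c') = circuitTime τ c + circuitTime τ c' := by
  simp [circuitTime]

theorem circuitTime_cons {a : ℕ} (τ : ℝ) (s : Step Q M a) (c : Circuit Q M a) :
    circuitTime τ (s :: c) = s.time τ + circuitTime τ c := by
  simp [circuitTime]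

/-- The gate of an instruction. -/
def Instruction.step {a : ℕ} (i : Instruction (Qubit Q M a)) : Step Q M a :=
  .gate 3 le_rfl i.2 ⟨pullbackMatrix (xorMap i.1), pullbackMatrix_mem (xorMap_involutive i.1)⟩

/-- The sign gate of a predicate on three selected qubits. -/
def signStep {a : ℕ} (h : (Fin 3 → Bool) → Bool) (e : Fin 3 ↪ Qubit Q M a) : Step Q M a :=
  .gate 3 le_rfl e ⟨signMatrix h, signMatrix_mem h⟩

/-- Run the program, apply the sign, and undo the program. -/
def signCircuit {a : ℕ} (h : (Fin 3 → Bool) → Bool) (e : Fin 3 ↪ Qubit Q M a) :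
    List (Instruction (Qubit Q M a)) → Circuit Q M a
  | [] => [signStep h e]
  | i :: l => i.step :: (signCircuit h e l ++ [i.step])

/-- Every instruction is its own inverse, so running the program backwards restores the basis state
and only the sign survives. -/
theorem circuitOp_signCircuit {a : ℕ} (UM UN : Matrix.unitaryGroup (DataQubit Q M → Bool) ℂ)
    (h : (Fin 3 → Bool) → Bool) (e : Fin 3 ↪ Qubit Q M a) (l : List (Instruction (Qubit Q M a)))
    (ψ : (Qubit Q M a → Bool) → ℂ) (x : Qubit Q M a → Bool) :
    (circuitOp UM UN (signCircuit h e l) *ᵥ ψ) x =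
      (if h (runProgram l x ∘ e) then -1 else 1) * ψ x := by
  induction l generalizing ψ x with
  | nil =>
    simp only [signCircuit, circuitOp, one_mul]
    exact actOn_signMatrix e h ψ x
  | cons i l ih =>
    have hi : ∀ (φ : (Qubit Q M a → Bool) → ℂ) (y : Qubit Q M a → Bool),
        (Step.op UM UN i.step *ᵥ φ) y = φ (i.run y) := fun φ y =>
      actOn_pullbackMatrix i.2 (xorMap i.1) φ y
    rw [signCircuit, circuitOp, circuitOp_append, circuitOp, circuitOp, one_mul,
      ← Matrix.mulVec_mulVec, ← Matrix.mulVec_mulVec, hi, ih, hi, i.run_involutive x]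
    rfl

theorem circuitTime_signCircuit {a : ℕ} (τ : ℝ) (h : (Fin 3 → Bool) → Bool)
    (e : Fin 3 ↪ Qubit Q M a) (l : List (Instruction (Qubit Q M a))) :
    circuitTime τ (signCircuit h e l) = 2 * l.length + 1 := by
  induction l with
  | nil => simp [signCircuit, circuitTime, signStep, Step.time]
  | cons i l ih =>
    rw [signCircuit, circuitTime_cons, circuitTime_append, ih]
    simp [circuitTime, Instruction.step, Step.time]
    ring

/-- The instruction that computes the flag `s + 1` from the flag `s` and a data bit. -/
def foldInstruction {n : ℕ} [NeZero n] (s : ℕ) (w : DataQubit Q M) (g : Bool → Bool → Bool) :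
    Instruction (Qubit Q M (n + 1)) :=
  -- `Fin.ofNat` reduces `s` modulo `n`, which keeps the definition total; the correctness lemma
  -- needs only `s < n`.
  (g, ⟨![Sum.inr (Fin.ofNat n s).castSucc, Sum.inl w, Sum.inr (Fin.ofNat n s).succ], by
    intro i j h
    have := (Fin.castSucc_lt_succ (i := Fin.ofNat n s)).ne
    fin_cases i <;> fin_cases j <;> simp_all⟩)

/-- The program that folds a list of data bits into the flags `s, s + 1, …`. -/
def foldProgram {n : ℕ} [NeZero n] :
    ℕ → List (DataQubit Q M × (Bool → Bool → Bool)) → List (Instruction (Qubit Q M (n + 1)))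
  | _, [] => []
  | s, p :: l => foldInstruction s p.1 p.2 :: foldProgram (s + 1) l

theorem length_foldProgram {n : ℕ} [NeZero n] (s : ℕ)
    (l : List (DataQubit Q M × (Bool → Bool → Bool))) :
    (foldProgram (n := n) s l).length = l.length := by
  induction l generalizing s with
  | nil => rfl
  | cons p l ih => simp [foldProgram, ih]

/-- The value computed by a fold. -/
def foldBits (l : List (DataQubit Q M × (Bool → Bool → Bool))) (f : Bool)
    (y : DataQubit Q M → Bool) : Bool :=
  l.foldl (fun f p => p.2 f (y p.1)) f

/-- Each flag starts at zero, so adding `g` to it writes the next fold value. That all other qubits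
stay unchanged is what lets a second fold run afterwards. -/
theorem runProgram_foldProgram {n : ℕ} [NeZero n] (s : ℕ)
    (l : List (DataQubit Q M × (Bool → Bool → Bool))) (hs : s + l.length ≤ n)
    (x : Qubit Q M (n + 1) → Bool)
    (hx : ∀ t : Fin (n + 1), s < t.val → t.val ≤ s + l.length → x (Sum.inr t) = false) :
    (∀ w, runProgram (foldProgram s l) x (Sum.inl w) = x (Sum.inl w)) ∧
    (∀ t : Fin (n + 1), ¬ (s < t.val ∧ t.val ≤ s + l.length) →
      runProgram (foldProgram s l) x (Sum.inr t) = x (Sum.inr t)) ∧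
    runProgram (foldProgram s l) x (Sum.inr ⟨s + l.length, by omega⟩) =
      foldBits l (x (Sum.inr ⟨s, by omega⟩)) (x ∘ Sum.inl) := by
  induction l generalizing s x with
  | nil => exact ⟨fun _ => rfl, fun _ _ => rfl, rfl⟩
  | cons p l ih =>
    have hlen : s + (l.length + 1) ≤ n := by simpa using hs
    have hsn : s < n := by omega
    have hof : (Fin.ofNat n s).val = s := Nat.mod_eq_of_lt hsn
    set i : Instruction (Qubit Q M (n + 1)) := foldInstruction s p.1 p.2 with hi
    have e0 : i.2 0 = Sum.inr ⟨s, by omega⟩ := by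
      change Sum.inr (Fin.ofNat n s).castSucc = _
      congr 1
      exact Fin.ext hof
    have e1 : i.2 1 = Sum.inl p.1 := rfl
    have e2 : i.2 2 = Sum.inr ⟨s + 1, by omega⟩ := by
      change Sum.inr (Fin.ofNat n s).succ = _
      congr 1
      exact Fin.ext (by simp [Nat.mod_eq_of_lt hsn])
    have hdata : ∀ w, i.run x (Sum.inl w) = x (Sum.inl w) := fun w =>
      i.run_apply_of_ne x (by rw [e2]; exact Sum.inl_ne_inr)
    have hanc : ∀ t : Fin (n + 1), t.val ≠ s + 1 → i.run x (Sum.inr t) = x (Sum.inr t) :=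
      fun t ht => i.run_apply_of_ne x (by
        rw [e2]; intro h; exact ht (congrArg Fin.val (Sum.inr.inj h)))
    have htgt : i.run x (Sum.inr ⟨s + 1, by omega⟩) =
        p.2 (x (Sum.inr ⟨s, by omega⟩)) (x (Sum.inl p.1)) := by
      have := i.run_target x
      rw [e0, e1, e2, hx _ (by simp) (by simp)] at this
      rw [this, Bool.false_xor]
      rfl
    obtain ⟨h1, h2, h3⟩ := ih (s + 1) (by omega) (i.run x) (fun t ht ht' => by
      rw [hanc t (by omega)]
      exact hx t (by omega) (by simp; omega))
    refine ⟨fun w => (h1 w).trans (hdata w), fun t ht => ?_, ?_⟩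
    · simp only [List.length_cons] at ht
      exact (h2 t (by omega)).trans (hanc t (by omega))
    · have hidx : (⟨s + (p :: l).length, by simp; omega⟩ : Fin (n + 1)) =
          ⟨s + 1 + l.length, by omega⟩ := Fin.ext (by simp; omega)
      rw [hidx]
      refine h3.trans ?_
      rw [htgt]
      have : (i.run x ∘ Sum.inl : DataQubit Q M → Bool) = x ∘ Sum.inl := funext hdata
      rw [this]
      rfl

/-- The three qubits that a reflection looks at: the control qubit and the results of two folds
of lengths `k` and `k'`. -/
def flagEmbedding {n : ℕ} (k k' : ℕ) (h : k + k' + 2 ≤ n) : Fin 3 ↪ Qubit Q M (n + 1) :=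
  ⟨![Sum.inr 0, Sum.inr ⟨1 + k, by omega⟩, Sum.inr ⟨2 + k + k', by omega⟩], by
    intro i j hij
    fin_cases i <;> fin_cases j <;> simp [Fin.ext_iff] at hij ⊢ <;> omega⟩

/-- The circuit that changes the sign of the basis states on which both folds give `false`,
if the predicate `d` of the control qubit holds. -/
def reflectionCircuit {n : ℕ} [NeZero n] (d : Bool → Bool)
    (l l' : List (DataQubit Q M × (Bool → Bool → Bool))) (h : l.length + l'.length + 2 ≤ n) :
    Circuit Q M (n + 1) :=
  -- Ancilla `0` is the control. The first fold starts from the clean ancilla `1` and ends at `1 +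
  -- l.length`; the second starts from the next clean one.
  signCircuit (fun a => d (a 0) && !(a 1) && !(a 2)) (flagEmbedding l.length l'.length h)
    (foldProgram 1 l ++ foldProgram (2 + l.length) l')

theorem circuitTime_reflectionCircuit {n : ℕ} [NeZero n] (τ : ℝ) (d : Bool → Bool)
    (l l' : List (DataQubit Q M × (Bool → Bool → Bool))) (h : l.length + l'.length + 2 ≤ n) :
    circuitTime τ (reflectionCircuit d l l' h) ≤ 2 * n := by
  rw [reflectionCircuit, circuitTime_signCircuit, List.length_append, length_foldProgram,
    length_foldProgram]
  have : ((l.length + l'.length + 2 : ℕ) : ℝ) ≤ n := by exact_mod_cast h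
  push_cast at this ⊢
  linarith

/-- The circuit is diagonal, so basis states with a nonzero work qubit keep amplitude zero and only
clean flags matter. -/
theorem circuitOp_reflectionCircuit {n : ℕ} [NeZero n]
    (UM UN : Matrix.unitaryGroup (DataQubit Q M → Bool) ℂ) (d : Bool → Bool)
    (l l' : List (DataQubit Q M × (Bool → Bool → Bool))) (h : l.length + l'.length + 2 ≤ n)
    (Ψ : Bool → (DataQubit Q M → Bool) → ℂ) :
    circuitOp UM UN (reflectionCircuit d l l' h) *ᵥ controlledState (n := n) Ψ =
      controlledState fun c => if d c then
        signMatrix (fun y => !foldBits l false y && !foldBits l' false y) *ᵥ Ψ c else Ψ c := by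
  funext x
  rw [reflectionCircuit, circuitOp_signCircuit]
  by_cases hx : ∀ t : Fin n, x (Sum.inr t.succ) = false
  · have hx' : ∀ t : Fin (n + 1), t.val ≠ 0 → x (Sum.inr t) = false := fun t ht => by
      obtain ⟨s, rfl⟩ := Fin.exists_succ_eq.2 (fun h => ht (by simp [h]) : t ≠ 0)
      exact hx s
    rw [runProgram_append]
    obtain ⟨a1, a2, a3⟩ := runProgram_foldProgram (n := n) 1 l (by omega) x
      (fun t ht _ => hx' t (by omega))
    set y := runProgram (foldProgram 1 l) x with hy
    obtain ⟨b1, b2, b3⟩ := runProgram_foldProgram (n := n) (2 + l.length) l' (by omega) y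
      (fun t ht _ => by rw [a2 t (by omega)]; exact hx' t (by omega))
    set z := runProgram (foldProgram (2 + l.length) l') y with hz
    have hyx : (y ∘ Sum.inl : DataQubit Q M → Bool) = x ∘ Sum.inl := funext a1
    have f0 : z (Sum.inr 0) = x (Sum.inr 0) := by
      rw [b2 0 (by simp), a2 0 (by simp)]
    have f1 : z (Sum.inr ⟨1 + l.length, by omega⟩) = foldBits l false (x ∘ Sum.inl) := by
      rw [b2 _ (by simp), a3, hx' _ (by simp)]
    have f2 : z (Sum.inr ⟨2 + l.length + l'.length, by omega⟩) =
        foldBits l' false (x ∘ Sum.inl) := by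
      rw [b3, a2 _ (by simp), hx' _ (by simp), hyx]
    have g0 : (z ∘ flagEmbedding l.length l'.length h) 0 = x (Sum.inr 0) := f0
    have g1 : (z ∘ flagEmbedding l.length l'.length h) 1 = foldBits l false (x ∘ Sum.inl) := f1
    have g2 : (z ∘ flagEmbedding l.length l'.length h) 2 = foldBits l' false (x ∘ Sum.inl) := f2
    rw [g0, g1, g2]
    simp only [controlledState, if_pos hx]
    by_cases hd : d (x (Sum.inr 0)) = true
    · simp [hd, signMatrix, Matrix.mulVec_diagonal]
    · simp [hd]
  · simp only [controlledState, if_neg hx, mul_zero]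

/-! ### Exchanging the column registers -/

/-- The embedding of the `t`-th qubits of both column registers. -/
def columnPair {a : ℕ} (t : Fin (Nat.clog 2 M)) : Fin 2 ↪ Qubit Q M a :=
  ⟨![Sum.inl (Sum.inr (Sum.inl t)), Sum.inl (Sum.inr (Sum.inr t))], by
    intro i j h
    fin_cases i <;> fin_cases j <;> simp_all⟩

theorem swapBits_involutive :
    Function.Involutive fun a : Fin 2 → Bool => a ∘ Equiv.swap 0 1 := by
  intro a; funext k; simp

def swapStep {a : ℕ} (t : Fin (Nat.clog 2 M)) : Step Q M a :=
  .gate 2 (by norm_num) (columnPair t) ⟨pullbackMatrix fun a => a ∘ Equiv.swap 0 1,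
    pullbackMatrix_mem swapBits_involutive⟩

/-- The circuit that exchanges the two column registers. -/
def swapCircuit (Q M a : ℕ) : Circuit Q M a := (List.finRange (Nat.clog 2 M)).map swapStep

theorem circuitTime_swapCircuit (τ : ℝ) (a : ℕ) :
    circuitTime τ (swapCircuit Q M a) = Nat.clog 2 M := by
  simp [circuitTime, swapCircuit, Function.comp_def, swapStep, Step.time]

/-- Exchange of the column registers in a basis state of the data qubits. -/
def swapData (y : DataQubit Q M → Bool) : DataQubit Q M → Bool :=
  y ∘ Sum.map id Sum.swap

/-- Exchange of the selected column qubits. -/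
def swapPart {a : ℕ} (l : List (Fin (Nat.clog 2 M))) (x : Qubit Q M a → Bool) :
    Qubit Q M a → Bool
  | Sum.inl (Sum.inr (Sum.inl t)) =>
      if t ∈ l then x (Sum.inl (Sum.inr (Sum.inr t))) else x (Sum.inl (Sum.inr (Sum.inl t)))
  | Sum.inl (Sum.inr (Sum.inr t)) =>
      if t ∈ l then x (Sum.inl (Sum.inr (Sum.inl t))) else x (Sum.inl (Sum.inr (Sum.inr t)))
  | w => x w

/-- A duplicate-free list gives exchanges on disjoint pairs of qubits, so they do not interfere. -/
theorem circuitOp_map_swapStep {a : ℕ} (UM UN : Matrix.unitaryGroup (DataQubit Q M → Bool) ℂ)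
    (l : List (Fin (Nat.clog 2 M))) (hl : l.Nodup) (ψ : (Qubit Q M a → Bool) → ℂ) :
    circuitOp UM UN (l.map swapStep) *ᵥ ψ = fun x => ψ (swapPart l x) := by
  induction l generalizing ψ with
  | nil =>
    simp only [List.map_nil, circuitOp, Matrix.one_mulVec]
    funext x
    congr 1
    funext w
    rcases w with (w | w | w) | w <;> simp [swapPart]
  | cons t l ih =>
    rw [List.map_cons, circuitOp, ← Matrix.mulVec_mulVec, ih (List.nodup_cons.1 hl).2]
    funext x
    refine (actOn_pullbackMatrix _ _ ψ _).trans ?_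
    congr 1
    have htl := (List.nodup_cons.1 hl).1
    have c0 : (columnPair t : Fin 2 ↪ Qubit Q M a) 0 = Sum.inl (Sum.inr (Sum.inl t)) := rfl
    have c1 : (columnPair t : Fin 2 ↪ Qubit Q M a) 1 = Sum.inl (Sum.inr (Sum.inr t)) := rfl
    funext w
    by_cases hw : ∃ k, (columnPair t : Fin 2 ↪ Qubit Q M a) k = w
    · obtain ⟨k, rfl⟩ := hw
      rw [(columnPair t).injective.extend_apply]
      fin_cases k
      · simp [c0, c1, swapPart, htl]
      · simp [c0, c1, swapPart, htl]
    · rw [Function.extend_apply' _ _ _ hw]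
      rcases w with (w | w | w) | w
      · rfl
      · have : w ≠ t := fun h => hw ⟨0, by rw [c0, h]⟩
        simp [swapPart, this]
      · have : w ≠ t := fun h => hw ⟨1, by rw [c1, h]⟩
        simp [swapPart, this]
      · rfl

theorem circuitOp_swapCircuit {n : ℕ} (UM UN : Matrix.unitaryGroup (DataQubit Q M → Bool) ℂ)
    (Ψ : Bool → (DataQubit Q M → Bool) → ℂ) :
    circuitOp UM UN (swapCircuit Q M (n + 1)) *ᵥ controlledState Ψ =
      controlledState fun c y => Ψ c (swapData y) := by
  rw [swapCircuit, circuitOp_map_swapStep UM UN _ (List.nodup_finRange _)]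
  funext x
  have h1 : ∀ t, swapPart (List.finRange (Nat.clog 2 M)) x (Sum.inr t) = x (Sum.inr t) :=
    fun t => rfl
  have h2 : (swapPart (List.finRange (Nat.clog 2 M)) x ∘ Sum.inl) =
      swapData (x ∘ Sum.inl) := by
    funext w
    rcases w with w | w | w <;> simp [swapPart, swapData]
  simp only [controlledState, h1, h2]

end Program

end Circuits

/-! ### Comparators, basis states, loaders and norms of the steering matrix. -/

noncomputable section Registers

variable {Q M : ℕ}

/-! ### Comparators -/

/-- The folding steps that compare a register with the number `q`, least significant bit first. -/
def compareList {n : ℕ} (ι : Fin n → DataQubit Q M) (q : ℕ) :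
    List (DataQubit Q M × (Bool → Bool → Bool)) :=
  (List.finRange n).map fun t => (ι t, fun f b => if b = q.testBit t then f else b)

theorem length_compareList {n : ℕ} (ι : Fin n → DataQubit Q M) (q : ℕ) :
    (compareList ι q).length = n := by
  simp [compareList]

theorem foldBits_append (l l' : List (DataQubit Q M × (Bool → Bool → Bool))) (f : Bool)
    (y : DataQubit Q M → Bool) :
    foldBits (l ++ l') f y = foldBits l' (foldBits l f y) y := by
  simp [foldBits]

/-- Scanning upwards, a differing bit overrides all earlier verdicts and an equal bit keeps them; a
tie in all bits returns the initial flag. -/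
theorem foldBits_compareList_mod {n : ℕ} (ι : Fin n → DataQubit Q M) (q v : ℕ) (f : Bool)
    (y : DataQubit Q M → Bool) (hy : ∀ t, y (ι t) = v.testBit t) :
    foldBits (compareList ι q) f y =
      (decide (q % 2 ^ n < v % 2 ^ n) || (decide (q % 2 ^ n = v % 2 ^ n) && f)) := by
  induction n with
  | zero => simp [compareList, foldBits, Nat.mod_one]
  | succ n ih =>
    have e : compareList ι q = compareList (fun t => ι t.castSucc) q ++
        [(ι (Fin.last n), fun f b => if b = q.testBit n then f else b)] := by
      simp [compareList, List.finRange_succ_last, Function.comp_def]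
    rw [e, foldBits_append, ih _ (fun t => hy t.castSucc)]
    simp only [foldBits, List.foldl_cons, List.foldl_nil, hy (Fin.last n), Fin.val_last]
    rw [Nat.mod_pow_succ (x := q), Nat.mod_pow_succ (x := v), Nat.testBit_eq_decide_div_mod_eq,
      Nat.testBit_eq_decide_div_mod_eq]
    have hq := Nat.mod_lt q (pow_pos (two_pos) n)
    have hv := Nat.mod_lt v (pow_pos (two_pos) n)
    rcases Nat.mod_two_eq_zero_or_one (q / 2 ^ n) with h1 | h1 <;>
      rcases Nat.mod_two_eq_zero_or_one (v / 2 ^ n) with h2 | h2 <;>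
      simp only [h1, h2]
    · simp
    · have : q % 2 ^ n < v % 2 ^ n + 2 ^ n := by omega
      simp [this]
    · have a : ¬ q % 2 ^ n + 2 ^ n < v % 2 ^ n := by omega
      have b : ¬ q % 2 ^ n + 2 ^ n = v % 2 ^ n := by omega
      simp [a, b]
    · simp

/-- For `q = 0` this is the disjunction of `f` with `v ≠ 0`, so zero tests can be chained after
another test. For `q > 0` a value `v < q` erases `f`, so a positive threshold must come first in its
fold; this is why the columns need two folds. -/
theorem foldBits_compareList {n : ℕ} (ι : Fin n → DataQubit Q M) {q v : ℕ} (f : Bool)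
    (y : DataQubit Q M → Bool) (hy : ∀ t, y (ι t) = v.testBit t) (hq : q < 2 ^ n)
    (hv : v < 2 ^ n) :
    foldBits (compareList ι q) f y = (decide (q < v) || (decide (q = v) && f)) := by
  rw [foldBits_compareList_mod ι q v f y hy, Nat.mod_eq_of_lt hq, Nat.mod_eq_of_lt hv]

/-! ### Basis states -/

/-- The bit string of the basis state `|i⟩|j₁⟩|j₂⟩`. -/
def basisIndex (Q M i j₁ j₂ : ℕ) : DataQubit Q M → Bool :=
  Sum.elim (bits _ i) (Sum.elim (bits _ j₁) (bits _ j₂))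

theorem ket_eq (Q M i j₁ j₂ : ℕ) : ket Q M i j₁ j₂ = Pi.single (basisIndex Q M i j₁ j₂) 1 := rfl

theorem bits_ofBits {n : ℕ} (f : Fin n → Bool) : bits n (Nat.ofBits f) = f := by
  funext t
  simp [bits]

theorem bits_inj {n x y : ℕ} (hx : x < 2 ^ n) (hy : y < 2 ^ n) (h : bits n x = bits n y) :
    x = y := by
  apply Nat.eq_of_testBit_eq
  intro t
  by_cases ht : t < n
  · exact congrFun h ⟨t, ht⟩
  · rw [Nat.testBit_lt_two_pow (hx.trans_le (Nat.pow_le_pow_right two_pos (by omega))),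
      Nat.testBit_lt_two_pow (hy.trans_le (Nat.pow_le_pow_right two_pos (by omega)))]

theorem exists_basisIndex (y : DataQubit Q M → Bool) :
    ∃ i < 2 ^ Nat.clog 2 Q, ∃ j₁ < 2 ^ Nat.clog 2 M, ∃ j₂ < 2 ^ Nat.clog 2 M,
      y = basisIndex Q M i j₁ j₂ := by
  refine ⟨_, Nat.ofBits_lt_two_pow fun t => y (Sum.inl t), _,
    Nat.ofBits_lt_two_pow fun t => y (Sum.inr (Sum.inl t)), _,
    Nat.ofBits_lt_two_pow fun t => y (Sum.inr (Sum.inr t)), ?_⟩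
  funext w
  rcases w with w | w | w <;> simp [basisIndex, bits_ofBits]

theorem basisIndex_inj {i j₁ j₂ i' j₁' j₂' : ℕ} (hi : i < 2 ^ Nat.clog 2 Q)
    (hj₁ : j₁ < 2 ^ Nat.clog 2 M) (hj₂ : j₂ < 2 ^ Nat.clog 2 M) (hi' : i' < 2 ^ Nat.clog 2 Q)
    (hj₁' : j₁' < 2 ^ Nat.clog 2 M) (hj₂' : j₂' < 2 ^ Nat.clog 2 M) :
    basisIndex Q M i j₁ j₂ = basisIndex Q M i' j₁' j₂' ↔ i = i' ∧ j₁ = j₁' ∧ j₂ = j₂' := by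
  constructor
  · intro h
    exact ⟨bits_inj hi hi' (funext fun t => congrFun h (Sum.inl t)),
      bits_inj hj₁ hj₁' (funext fun t => congrFun h (Sum.inr (Sum.inl t))),
      bits_inj hj₂ hj₂' (funext fun t => congrFun h (Sum.inr (Sum.inr t)))⟩
  · rintro ⟨rfl, rfl, rfl⟩; rfl

theorem fin_lt_two_pow_clog {n : ℕ} (i : Fin n) : i.val < 2 ^ Nat.clog 2 n :=
  i.2.trans_le (Nat.le_pow_clog one_lt_two n)

/-- The bit string of `|i⟩|0⟩`. -/
def rowIndex (M : ℕ) (i : Fin Q) : DataQubit Q M → Bool := basisIndex Q M i 0 0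

/-- The bit string of `|0⟩|j⟩`. -/
def columnIndex (Q : ℕ) (j : Fin M × Fin M) : DataQubit Q M → Bool := basisIndex Q M 0 j.1 j.2

theorem rowIndex_injective : Function.Injective (rowIndex M : Fin Q → _) := fun i i' h =>
  Fin.ext ((basisIndex_inj (fin_lt_two_pow_clog i) (by positivity) (by positivity)
    (fin_lt_two_pow_clog i') (by positivity) (by positivity)).1 h).1

theorem columnIndex_injective : Function.Injective (columnIndex Q : Fin M × Fin M → _) :=
  fun j j' h => by
    have := (basisIndex_inj (by positivity) (fin_lt_two_pow_clog j.1) (fin_lt_two_pow_clog j.2)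
      (by positivity) (fin_lt_two_pow_clog j'.1) (fin_lt_two_pow_clog j'.2)).1 h
    exact Prod.ext (Fin.ext this.2.1) (Fin.ext this.2.2)

/-- The qubits of the row register. -/
def rowWire (Q M : ℕ) : Fin (Nat.clog 2 Q) → DataQubit Q M := Sum.inl

/-- The qubits of the first column register. -/
def columnWire₁ (Q M : ℕ) : Fin (Nat.clog 2 M) → DataQubit Q M := fun t => Sum.inr (Sum.inl t)

/-- The qubits of the second column register. -/
def columnWire₂ (Q M : ℕ) : Fin (Nat.clog 2 M) → DataQubit Q M := fun t => Sum.inr (Sum.inr t)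

/-- The fold that rejects everything except the states `|i⟩|0⟩` with `i < Q`. -/
def rowList (Q M : ℕ) : List (DataQubit Q M × (Bool → Bool → Bool)) :=
  compareList (rowWire Q M) (Q - 1) ++ compareList (columnWire₁ Q M) 0 ++
    compareList (columnWire₂ Q M) 0

/-- The fold that rejects nonzero rows and first column indices that are not below `M`. -/
def columnList₁ (Q M : ℕ) : List (DataQubit Q M × (Bool → Bool → Bool)) :=
  compareList (columnWire₁ Q M) (M - 1) ++ compareList (rowWire Q M) 0

/-- The fold that rejects second column indices that are not below `M`. -/
def columnList₂ (Q M : ℕ) : List (DataQubit Q M × (Bool → Bool → Bool)) :=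
  compareList (columnWire₂ Q M) (M - 1)

theorem rowFlag_eq (hQ : 1 ≤ Q) (y : DataQubit Q M → Bool) :
    (!foldBits (rowList Q M) false y && !foldBits ([] : List (DataQubit Q M × _)) false y) = true ↔
      ∃ i : Fin Q, rowIndex M i = y := by
  obtain ⟨i, hi, j₁, hj₁, j₂, hj₂, rfl⟩ := exists_basisIndex y
  rw [rowList, foldBits_append, foldBits_append,
    foldBits_compareList (rowWire Q M) (v := i) false _ (fun t => rfl)
      (by have := Nat.le_pow_clog one_lt_two Q; omega) hi,
    foldBits_compareList (columnWire₁ Q M) (v := j₁) _ _ (fun t => rfl) (by positivity) hj₁,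
    foldBits_compareList (columnWire₂ Q M) (v := j₂) _ _ (fun t => rfl) (by positivity) hj₂]
  simp only [foldBits, List.foldl_nil]
  simp only [Bool.and_false, Bool.or_false, Bool.not_false, Bool.and_true, Bool.not_eq_true',
    Bool.or_eq_false_iff, decide_eq_false_iff_not, Bool.and_eq_false_iff]
  constructor
  · intro h
    exact ⟨⟨i, by omega⟩, (basisIndex_inj (by simpa using hi) (by positivity) (by positivity)
      hi hj₁ hj₂).2 ⟨rfl, by omega, by omega⟩⟩
  · rintro ⟨i', h⟩
    have := (basisIndex_inj (fin_lt_two_pow_clog i') (by positivity) (by positivity)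
      hi hj₁ hj₂).1 h
    have := i'.2
    omega

theorem columnFlag_eq (hM : 1 ≤ M) (y : DataQubit Q M → Bool) :
    (!foldBits (columnList₁ Q M) false y && !foldBits (columnList₂ Q M) false y) = true ↔
      ∃ j : Fin M × Fin M, columnIndex Q j = y := by
  obtain ⟨i, hi, j₁, hj₁, j₂, hj₂, rfl⟩ := exists_basisIndex y
  have hM' : M - 1 < 2 ^ Nat.clog 2 M := by
    have := Nat.le_pow_clog one_lt_two M; omega
  rw [columnList₁, columnList₂, foldBits_append,
    foldBits_compareList (columnWire₁ Q M) (v := j₁) _ _ (fun t => rfl) hM' hj₁,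
    foldBits_compareList (rowWire Q M) (v := i) _ _ (fun t => rfl) (by positivity) hi,
    foldBits_compareList (columnWire₂ Q M) (v := j₂) _ _ (fun t => rfl) hM' hj₂]
  simp only [Bool.and_false, Bool.or_false, Bool.not_eq_true', Bool.and_eq_true,
    Bool.or_eq_false_iff, decide_eq_false_iff_not, Bool.and_eq_false_iff]
  constructor
  · intro h
    exact ⟨(⟨j₁, by omega⟩, ⟨j₂, by omega⟩), (basisIndex_inj (by positivity)
      (by simpa using hj₁) (by simpa using hj₂) hi hj₁ hj₂).2 ⟨by omega, rfl, rfl⟩⟩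
  · rintro ⟨j, h⟩
    have := (basisIndex_inj (by positivity) (fin_lt_two_pow_clog j.1)
      (fin_lt_two_pow_clog j.2) hi hj₁ hj₂).1 h
    have := j.1.2
    have := j.2.2
    omega

/-! ### Embedding of vectors into the registers -/

/-- The vector with coefficients `u` on the basis states with the given indices. -/
def placeAt {α ι : Type*} [Fintype α] [DecidableEq ι] (f : α → ι) (u : α → ℂ) : ι → ℂ :=
  ∑ a, u a • (Pi.single (f a) 1 : ι → ℂ)

section PlaceAt

variable {α ι : Type*} [Fintype α] [DecidableEq ι] {f : α → ι}

theorem placeAt_apply (hf : Function.Injective f) (u : α → ℂ) (a : α) :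
    placeAt f u (f a) = u a := by
  classical
  simp [placeAt, Finset.sum_apply, Pi.single_apply, hf.eq_iff]

theorem placeAt_apply_of_notMem (u : α → ℂ) {y : ι} (hy : ∀ a, f a ≠ y) :
    placeAt f u y = 0 := by
  simp only [placeAt, Finset.sum_apply, Pi.smul_apply, Pi.single_apply, smul_eq_mul]
  refine Finset.sum_eq_zero fun a _ => ?_
  rw [if_neg (hy a).symm, mul_zero]

theorem dotProduct_placeAt [Fintype ι] (x : ι → ℂ) (u : α → ℂ) :
    x ⬝ᵥ placeAt f u = ∑ a, x (f a) * u a := by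
  rw [placeAt, dotProduct_sum]
  refine Finset.sum_congr rfl fun a _ => ?_
  rw [dotProduct_smul, dotProduct_single_one, smul_eq_mul, mul_comm]

theorem star_placeAt_dotProduct [Fintype ι] (hf : Function.Injective f) (u u' : α → ℂ) :
    star (placeAt f u) ⬝ᵥ placeAt f u' = star u ⬝ᵥ u' := by
  rw [dotProduct_placeAt]
  simp [placeAt_apply hf, dotProduct]

theorem placeAt_sum_smul {β : Type*} [Fintype β] (c : β → ℂ) (u : β → α → ℂ) :
    placeAt f (∑ k, c k • u k) = ∑ k, c k • placeAt f (u k) := by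
  simp only [placeAt, Finset.smul_sum, Finset.sum_apply, Pi.smul_apply, Finset.sum_smul,
    smul_assoc]
  rw [Finset.sum_comm]

/-- The sign matrix is `1 - 2 Π`, with `Π` the projection onto the marked basis states. -/
theorem signMatrix_mulVec_eq_sub [Fintype ι] (hf : Function.Injective f) {h : ι → Bool}
    (hh : ∀ y, h y = true ↔ ∃ a, f a = y) (x : ι → ℂ) :
    signMatrix h *ᵥ x = x - (2 : ℂ) • placeAt f fun a => x (f a) := by
  funext y
  rw [signMatrix, Matrix.mulVec_diagonal, Pi.sub_apply, Pi.smul_apply, smul_eq_mul]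
  by_cases hy : h y = true
  · obtain ⟨a, rfl⟩ := (hh y).1 hy
    rw [if_pos hy, placeAt_apply hf]; ring
  · rw [if_neg hy, placeAt_apply_of_notMem _ fun a ha => hy ((hh y).2 ⟨a, ha⟩)]; ring

theorem signMatrix_mulVec_placeAt [Fintype ι] (hf : Function.Injective f) {h : ι → Bool}
    (hh : ∀ y, h y = true ↔ ∃ a, f a = y) (u : α → ℂ) :
    signMatrix h *ᵥ placeAt f u = -placeAt f u := by
  rw [signMatrix_mulVec_eq_sub hf hh]
  simp only [placeAt_apply hf]
  module

end PlaceAt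

theorem placeAt_columnIndex_swap (v : Fin M × Fin M → ℂ) :
    (fun y => placeAt (columnIndex Q) (fun j => v j.swap) (swapData y)) =
      placeAt (columnIndex Q) v := by
  have hinv : Function.Involutive (swapData : (DataQubit Q M → Bool) → _) := fun y => by
    funext w; rcases w with w | w | w <;> rfl
  have hidx : ∀ j : Fin M × Fin M, swapData (columnIndex Q j) = columnIndex Q j.swap := fun j => by
    funext w; rcases w with w | w | w <;> rfl
  funext y
  by_cases hy : ∃ j, columnIndex Q j = y
  · obtain ⟨j, rfl⟩ := hy
    rw [hidx, placeAt_apply columnIndex_injective, placeAt_apply columnIndex_injective,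
      Prod.swap_swap]
  · rw [placeAt_apply_of_notMem, placeAt_apply_of_notMem]
    · exact fun j hj => hy ⟨j, hj⟩
    · intro j hj
      exact hy ⟨j.swap, by rw [← hidx, hj, hinv y]⟩

/-! ### The loaders -/

theorem star_ket_dotProduct_ket {i j₁ j₂ i' j₁' j₂' : ℕ} (hi : i < 2 ^ Nat.clog 2 Q)
    (hj₁ : j₁ < 2 ^ Nat.clog 2 M) (hj₂ : j₂ < 2 ^ Nat.clog 2 M) (hi' : i' < 2 ^ Nat.clog 2 Q)
    (hj₁' : j₁' < 2 ^ Nat.clog 2 M) (hj₂' : j₂' < 2 ^ Nat.clog 2 M) :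
    star (ket Q M i j₁ j₂) ⬝ᵥ ket Q M i' j₁' j₂' =
      if i = i' ∧ j₁ = j₁' ∧ j₂ = j₂' then 1 else 0 := by
  rw [ket_eq, ket_eq, dotProduct_single_one, Pi.star_apply, Pi.single_apply]
  simp only [eq_comm (a := basisIndex Q M i' j₁' j₂'),
    basisIndex_inj hi hj₁ hj₂ hi' hj₁' hj₂']
  split_ifs <;> simp

/-- Only the term with row `i` and column `j` is common to the two loaded states, and there the row
norm cancels. -/
theorem loader_overlap {A : Matrix (Fin Q) (Fin M × Fin M) ℂ}
    {UM UN : Matrix (DataQubit Q M → Bool) (DataQubit Q M → Bool) ℂ}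
    (hM : IsRowLoader A UM) (hN : IsNormLoader A UN) (hA : ∀ i, rowNorm A i ≠ 0)
    (i : Fin Q) (j : Fin M × Fin M) :
    star (UN *ᵥ ket Q M 0 j.1 j.2) ⬝ᵥ (UM *ᵥ ket Q M i 0 0) = A i j / (frobeniusNorm A : ℂ) := by
  rw [hM i, hN j, star_sum, sum_dotProduct, Finset.sum_eq_single i]
  · rw [dotProduct_sum, Finset.sum_eq_single j]
    · rw [star_smul, smul_dotProduct, dotProduct_smul, star_ket_dotProduct_ket
        (fin_lt_two_pow_clog _) (fin_lt_two_pow_clog _) (fin_lt_two_pow_clog _)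
        (fin_lt_two_pow_clog _) (fin_lt_two_pow_clog _) (fin_lt_two_pow_clog _)]
      have h1 : star ((rowNorm A i : ℂ) / (frobeniusNorm A : ℂ)) =
          (rowNorm A i : ℂ) / (frobeniusNorm A : ℂ) := by
        rw [← Complex.ofReal_div]; exact Complex.conj_ofReal _
      have h2 : (rowNorm A i : ℂ) ≠ 0 := by exact_mod_cast hA i
      rw [h1]
      simp
      field_simp
    · intro j' _ hj'
      rw [star_smul, smul_dotProduct, dotProduct_smul, star_ket_dotProduct_ket
        (fin_lt_two_pow_clog _) (fin_lt_two_pow_clog _) (fin_lt_two_pow_clog _)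
        (fin_lt_two_pow_clog _) (fin_lt_two_pow_clog _) (fin_lt_two_pow_clog _), if_neg]
      · simp
      · rintro ⟨-, h1, h2⟩
        exact hj' (Prod.ext (Fin.ext h1.symm) (Fin.ext h2.symm))
    · simp
  · intro i' _ hi'
    rw [dotProduct_sum]
    refine Finset.sum_eq_zero fun j' _ => ?_
    rw [star_smul, smul_dotProduct, dotProduct_smul, star_ket_dotProduct_ket
        (fin_lt_two_pow_clog _) (fin_lt_two_pow_clog _) (fin_lt_two_pow_clog _)
        (fin_lt_two_pow_clog _) (fin_lt_two_pow_clog _) (fin_lt_two_pow_clog _), if_neg]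
    · simp
    · rintro ⟨h1, -⟩
      exact hi' (Fin.ext h1)
  · simp

/-! ### The steering matrix -/

section Steering

variable (d lam : ℝ) (θ : Fin Q → ℝ)

theorem norm_steeringVector (φ : ℝ) (m : Fin M) : ‖steeringVector M d lam φ m‖ = 1 := by
  rw [steeringVector, neg_mul, mul_comm, ← neg_mul, ← Complex.ofReal_neg]
  exact Complex.norm_exp_ofReal_mul_I _

theorem norm_steeringMatrix (i : Fin Q) (j : Fin M × Fin M) :
    ‖steeringMatrix M d lam θ i j‖ = 1 := by
  simp [steeringMatrix, norm_steeringVector]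

/-- The Kronecker structure makes conjugation an exchange of the column indices. This is what
repairs the transpose supplied by the loaders. -/
theorem star_steeringMatrix (i : Fin Q) (j : Fin M × Fin M) :
    star (steeringMatrix M d lam θ i j) = steeringMatrix M d lam θ i j.swap := by
  simp [steeringMatrix, mul_comm]

theorem rowNorm_steeringMatrix (i : Fin Q) : rowNorm (steeringMatrix M d lam θ) i = M := by
  rw [rowNorm, EuclideanSpace.norm_eq]
  simp only [norm_steeringMatrix]
  simp

/-- All entries have modulus one. The norm does not depend on the angles, so a circuit chosen from
it depends only on `Q`, `M` and `ε`. -/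
theorem frobeniusNorm_steeringMatrix : frobeniusNorm (steeringMatrix M d lam θ) = √Q * M := by
  rw [frobeniusNorm, Matrix.frobenius_norm_def]
  simp only [norm_steeringMatrix]
  have : ((Q : ℝ) * ((M : ℝ) * M)) = (√Q * M) ^ 2 := by
    rw [mul_pow, Real.sq_sqrt (Nat.cast_nonneg Q)]; ring
  simp only [one_pow, Real.rpow_ofNat, Finset.sum_const, Finset.card_univ, Fintype.card_prod,
    Fintype.card_fin, nsmul_eq_mul, mul_one, Nat.cast_mul]
  rw [this, ← Real.sqrt_eq_rpow, Real.sqrt_sq (by positivity)]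

end Steering

end Registers

/-! ### Two reflections, their walk, and the error of the approximate half step. -/

noncomputable section SingularVectorTransition

open Polynomial

/-! ### Unitary matrices and dot products -/

section Unitary

variable {ι : Type*} [Fintype ι]

theorem star_mulVec_dotProduct (A : Matrix ι ι ℂ) (x y : ι → ℂ) :
    star (A *ᵥ x) ⬝ᵥ y = star x ⬝ᵥ (Aᴴ *ᵥ y) := by
  rw [Matrix.star_mulVec, Matrix.dotProduct_mulVec]

theorem star_dotProduct_comm (x y : ι → ℂ) : star (star x ⬝ᵥ y) = star y ⬝ᵥ x := by
  exact (Matrix.star_dotProduct y x).symm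

theorem star_dotProduct_self (x : ι → ℂ) :
    star x ⬝ᵥ x = ((∑ i, ‖x i‖ ^ 2 : ℝ) : ℂ) := by
  simp only [dotProduct, Pi.star_apply, Complex.ofReal_sum, ← mul_star_self_eq, mul_comm]

variable [DecidableEq ι]

theorem star_mulVec_dotProduct_mulVec {A : Matrix ι ι ℂ} (hA : A ∈ Matrix.unitaryGroup ι ℂ)
    (x y : ι → ℂ) : star (A *ᵥ x) ⬝ᵥ (A *ᵥ y) = star x ⬝ᵥ y := by
  rw [star_mulVec_dotProduct, Matrix.mulVec_mulVec, ← Matrix.star_eq_conjTranspose,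
    Matrix.mem_unitaryGroup_iff'.1 hA, Matrix.one_mulVec]

/-- The total squared norm of a state of the control qubit and the data is preserved by the
decomposition into rotations. -/
theorem sum_rotationPolys {W : Matrix ι ι ℂ} (hW : W ∈ Matrix.unitaryGroup ι ℂ)
    (l : List (Matrix Bool Bool ℂ)) (hl : ∀ R ∈ l, R ∈ Matrix.unitaryGroup Bool ℂ) (x : ι → ℂ) :
    ∑ c, star (aeval W (rotationPolys l c) *ᵥ x) ⬝ᵥ (aeval W (rotationPolys l c) *ᵥ x) =
      star x ⬝ᵥ x := by
  induction l with
  | nil => simp [rotationPolys]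
  | cons R l ih =>
    have hR := Matrix.mem_unitaryGroup_iff'.1 (hl R (by simp))
    have h := ih fun R' hR' => hl R' (by simp [hR'])
    set a := aeval W (rotationPolys l false) *ᵥ x with ha
    set b := aeval W (rotationPolys l true) *ᵥ x with hb
    have e : ∀ c, aeval W (rotationPolys (R :: l) c) *ᵥ x =
        R c false • a + R c true • (W *ᵥ b) := fun c => by
      simp only [rotationPolys, map_add, map_mul, aeval_C, aeval_X, Matrix.add_mulVec,
        ← Matrix.mulVec_mulVec, ← ha, ← hb, Algebra.algebraMap_eq_smul_one, Matrix.smul_mulVec,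
        Matrix.one_mulVec]
    have hbb := star_mulVec_dotProduct_mulVec hW b b
    rw [Fintype.sum_bool] at h ⊢
    rw [e, e, ← h, ← hbb]
    have r1 := congrFun (congrFun hR false) false
    have r2 := congrFun (congrFun hR false) true
    have r3 := congrFun (congrFun hR true) false
    have r4 := congrFun (congrFun hR true) true
    simp only [Matrix.mul_apply, Fintype.sum_bool, Matrix.star_apply, Matrix.one_apply] at r1 r2 r3 r4
    simp only [if_true, Bool.false_eq_true, if_false, reduceCtorEq] at r1 r2 r3 r4
    simp only [star_add, star_smul, add_dotProduct, dotProduct_add, smul_dotProduct,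
      dotProduct_smul, smul_eq_mul]
    linear_combination (star a ⬝ᵥ a) * r1 + (star a ⬝ᵥ (W *ᵥ b)) * r2 +
      (star (W *ᵥ b) ⬝ᵥ a) * r3 + (star (W *ᵥ b) ⬝ᵥ (W *ᵥ b)) * r4

end Unitary

/-! ### Two families of vectors rotated into each other by two reflections -/

/-- Two reflections and two orthonormal families `u`, `w` such that the reflections act on the
planes spanned by `u k`, `w k`, whose angle has cosine `s k`. -/
structure ReflectionPair {ι κ : Type*} [Fintype ι] [DecidableEq ι] [DecidableEq κ]
    (Z₁ Z₃ : Matrix ι ι ℂ) (u w : κ → ι → ℂ) (s : κ → ℝ) : Prop where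
  herm₁ : Z₁ᴴ = Z₁
  herm₃ : Z₃ᴴ = Z₃
  sq₁ : Z₁ * Z₁ = 1
  sq₃ : Z₃ * Z₃ = 1
  left : ∀ k l, star (u k) ⬝ᵥ u l = if k = l then 1 else 0
  right : ∀ k l, star (w k) ⬝ᵥ w l = if k = l then 1 else 0
  left₁ : ∀ k, Z₁ *ᵥ u k = -u k
  right₁ : ∀ k, Z₁ *ᵥ w k = w k - (2 * s k : ℂ) • u k
  left₃ : ∀ k, Z₃ *ᵥ u k = u k - (2 * s k : ℂ) • w k
  right₃ : ∀ k, Z₃ *ᵥ w k = -w k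

namespace ReflectionPair

variable {ι κ : Type*} [Fintype ι] [DecidableEq ι] [DecidableEq κ]
  {Z₁ Z₃ : Matrix ι ι ℂ} {u w : κ → ι → ℂ} {s : κ → ℝ}

/-- Self-adjointness of `Z₁` turns `⟨w, Z₁ u⟩ = ⟨Z₁ w, u⟩` into a linear equation for `⟨w, u⟩`. -/
theorem right_left (h : ReflectionPair Z₁ Z₃ u w s) (k l : κ) :
    star (w k) ⬝ᵥ u l = if k = l then (s k : ℂ) else 0 := by
  have h1 := star_mulVec_dotProduct Z₁ (w k) (u l)
  rw [h.herm₁, h.left₁, h.right₁, star_sub, star_smul, sub_dotProduct, smul_dotProduct,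
    h.left, dotProduct_neg] at h1
  have h2 : star (2 * (s k : ℂ)) = 2 * s k := by
    rw [← Complex.ofReal_ofNat, ← Complex.ofReal_mul]; exact Complex.conj_ofReal _
  rw [h2, smul_eq_mul] at h1
  split_ifs at h1 ⊢ <;> linear_combination h1 / 2

/-- `‖w k - u k‖² = 2 - 2 s k` is nonnegative. -/
theorem le_one (h : ReflectionPair Z₁ Z₃ u w s) (k : κ) : s k ≤ 1 := by
  have h1 := star_dotProduct_self (w k - u k)
  simp only [star_sub, sub_dotProduct, dotProduct_sub, h.left, h.right, h.right_left,
    if_true] at h1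
  rw [← star_dotProduct_comm, h.right_left, if_pos rfl] at h1
  have h2 : star (s k : ℂ) = s k := Complex.conj_ofReal _
  rw [h2] at h1
  have h3 := congrArg Complex.re h1
  simp only [Complex.sub_re, Complex.one_re, Complex.ofReal_re] at h3
  have h4 : 0 ≤ ∑ i, ‖(w k - u k) i‖ ^ 2 := Finset.sum_nonneg fun i _ => by positivity
  linarith

variable {θ : κ → ℝ}

theorem cos_add_eq (a b : ℝ) :
    Real.cos (a + b) = 2 * Real.cos b * Real.cos a - Real.cos (a - b) := by
  rw [Real.cos_add, Real.cos_sub]; ring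

/-- Moving the walk to the left factor closes the recursion on the overlaps with `u k` and `w k`
alone, for arbitrary `y`. -/
theorem walk_left (h : ReflectionPair Z₁ Z₃ u w s) (k : κ) (y : ι → ℂ) :
    star (u k) ⬝ᵥ ((Z₃ * Z₁) *ᵥ y) = (2 * s k) * ((2 * s k) * (star (u k) ⬝ᵥ y) -
      star (w k) ⬝ᵥ y) - star (u k) ⬝ᵥ y := by
  have h2 : star (2 * (s k : ℂ)) = 2 * s k := by
    rw [← Complex.ofReal_ofNat, ← Complex.ofReal_mul]; exact Complex.conj_ofReal _
  have e := star_mulVec_dotProduct (Z₁ * Z₃) (u k) y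
  rw [Matrix.conjTranspose_mul, h.herm₁, h.herm₃] at e
  rw [← e, ← Matrix.mulVec_mulVec, h.left₃, Matrix.mulVec_sub, Matrix.mulVec_smul, h.left₁,
    h.right₁]
  simp only [star_sub, star_neg, star_smul, sub_dotProduct, neg_dotProduct, smul_dotProduct, h2,
    smul_eq_mul]
  ring

theorem walk_right (h : ReflectionPair Z₁ Z₃ u w s) (k : κ) (y : ι → ℂ) :
    star (w k) ⬝ᵥ ((Z₃ * Z₁) *ᵥ y) = (2 * s k) * (star (u k) ⬝ᵥ y) - star (w k) ⬝ᵥ y := by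
  have h2 : star (2 * (s k : ℂ)) = 2 * s k := by
    rw [← Complex.ofReal_ofNat, ← Complex.ofReal_mul]; exact Complex.conj_ofReal _
  have e := star_mulVec_dotProduct (Z₁ * Z₃) (w k) y
  rw [Matrix.conjTranspose_mul, h.herm₁, h.herm₃] at e
  rw [← e, ← Matrix.mulVec_mulVec, h.right₃, Matrix.mulVec_neg, h.right₁]
  simp only [star_sub, star_neg, star_smul, sub_dotProduct, neg_dotProduct, smul_dotProduct, h2,
    smul_eq_mul]
  ring

theorem walkInv_left (h : ReflectionPair Z₁ Z₃ u w s) (k : κ) (y : ι → ℂ) :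
    star (u k) ⬝ᵥ ((Z₁ * Z₃) *ᵥ y) = (2 * s k) * (star (w k) ⬝ᵥ y) - star (u k) ⬝ᵥ y := by
  have h2 : star (2 * (s k : ℂ)) = 2 * s k := by
    rw [← Complex.ofReal_ofNat, ← Complex.ofReal_mul]; exact Complex.conj_ofReal _
  have e := star_mulVec_dotProduct (Z₃ * Z₁) (u k) y
  rw [Matrix.conjTranspose_mul, h.herm₁, h.herm₃] at e
  rw [← e, ← Matrix.mulVec_mulVec, h.left₁, Matrix.mulVec_neg, h.left₃]
  simp only [star_sub, star_neg, star_smul, sub_dotProduct, neg_dotProduct, smul_dotProduct, h2,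
    smul_eq_mul]
  ring

theorem walkInv_right (h : ReflectionPair Z₁ Z₃ u w s) (k : κ) (y : ι → ℂ) :
    star (w k) ⬝ᵥ ((Z₁ * Z₃) *ᵥ y) = (2 * s k) * ((2 * s k) * (star (w k) ⬝ᵥ y) -
      star (u k) ⬝ᵥ y) - star (w k) ⬝ᵥ y := by
  have h2 : star (2 * (s k : ℂ)) = 2 * s k := by
    rw [← Complex.ofReal_ofNat, ← Complex.ofReal_mul]; exact Complex.conj_ofReal _
  have e := star_mulVec_dotProduct (Z₃ * Z₁) (w k) y
  rw [Matrix.conjTranspose_mul, h.herm₁, h.herm₃] at e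
  rw [← e, ← Matrix.mulVec_mulVec, h.right₁, Matrix.mulVec_sub, Matrix.mulVec_smul, h.left₃,
    h.right₃]
  simp only [star_sub, star_neg, star_smul, sub_dotProduct, neg_dotProduct, smul_dotProduct, h2,
    smul_eq_mul]
  ring

/-- The walk rotates by `2 θ k`, with `u k` at angle `0` and `w k` at angle `θ k`; the recursion is
that of the Chebyshev polynomials. -/
theorem walk_pow (h : ReflectionPair Z₁ Z₃ u w s) (hθ : ∀ k, s k = Real.cos (θ k)) (n : ℕ)
    (k l : κ) :
    star (u k) ⬝ᵥ (((Z₃ * Z₁) ^ n) *ᵥ u l) =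
        (if k = l then (Real.cos (2 * n * θ k) : ℂ) else 0) ∧
      star (w k) ⬝ᵥ (((Z₃ * Z₁) ^ n) *ᵥ u l) =
        (if k = l then (Real.cos (2 * n * θ k - θ k) : ℂ) else 0) := by
  induction n with
  | zero => simp [h.left, h.right_left, hθ]
  | succ n ih =>
    rw [pow_succ', ← Matrix.mulVec_mulVec, h.walk_left, h.walk_right, ih.1, ih.2]
    by_cases hkl : k = l
    · simp only [if_pos hkl]
      have e1 : 2 * ((n + 1 : ℕ) : ℝ) * θ k = (2 * n * θ k + θ k) + θ k := by push_cast; ring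
      rw [e1, add_sub_cancel_right, cos_add_eq (2 * n * θ k + θ k) (θ k), add_sub_cancel_right,
        cos_add_eq (2 * n * θ k) (θ k), hθ]
      push_cast
      exact ⟨by ring, by ring⟩
    · simp [hkl]

theorem walkInv_pow (h : ReflectionPair Z₁ Z₃ u w s) (hθ : ∀ k, s k = Real.cos (θ k)) (n : ℕ)
    (k l : κ) :
    star (u k) ⬝ᵥ (((Z₁ * Z₃) ^ n) *ᵥ u l) =
        (if k = l then (Real.cos (2 * n * θ k) : ℂ) else 0) ∧
      star (w k) ⬝ᵥ (((Z₁ * Z₃) ^ n) *ᵥ u l) =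
        (if k = l then (Real.cos (2 * n * θ k + θ k) : ℂ) else 0) := by
  induction n with
  | zero => simp [h.left, h.right_left, hθ]
  | succ n ih =>
    rw [pow_succ', ← Matrix.mulVec_mulVec, h.walkInv_left, h.walkInv_right, ih.1, ih.2]
    by_cases hkl : k = l
    · simp only [if_pos hkl]
      have e1 : 2 * ((n + 1 : ℕ) : ℝ) * θ k = (2 * n * θ k + θ k) + θ k := by push_cast; ring
      rw [e1, cos_add_eq (2 * n * θ k + θ k + θ k) (θ k), add_sub_cancel_right,
        cos_add_eq (2 * n * θ k + θ k) (θ k), add_sub_cancel_right, hθ]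
      push_cast
      exact ⟨by ring, by ring⟩
    · simp [hkl]

/-- The two walks are mutually inverse, so the smaller power cancels and a pure power of one of them
remains. -/
theorem walkInv_pow_mul_walk_pow (h : ReflectionPair Z₁ Z₃ u w s)
    (hθ : ∀ k, s k = Real.cos (θ k)) (m n : ℕ) (k l : κ) :
    star (w k) ⬝ᵥ (((Z₁ * Z₃) ^ m * (Z₃ * Z₁) ^ n) *ᵥ u l) =
      if k = l then (Real.cos ((2 * ((n : ℝ) - m) - 1) * θ k) : ℂ) else 0 := by
  have e1 : (Z₁ * Z₃) * (Z₃ * Z₁) = 1 := by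
    rw [mul_assoc, ← mul_assoc Z₃, h.sq₃, one_mul, h.sq₁]
  have e2 : (Z₃ * Z₁) * (Z₁ * Z₃) = 1 := by
    rw [mul_assoc, ← mul_assoc Z₁, h.sq₁, one_mul, h.sq₃]
  have hcomm : Commute (Z₁ * Z₃) (Z₃ * Z₁) := e1.trans e2.symm
  have hone : ∀ t, (Z₁ * Z₃) ^ t * (Z₃ * Z₁) ^ t = 1 := fun t => by
    rw [← hcomm.mul_pow, e1, one_pow]
  rcases le_total m n with hmn | hmn
  · obtain ⟨t, rfl⟩ := Nat.exists_eq_add_of_le hmn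
    rw [pow_add, ← mul_assoc, hone, one_mul, (h.walk_pow hθ t k l).2]
    congr 3
    push_cast; ring
  · obtain ⟨t, rfl⟩ := Nat.exists_eq_add_of_le hmn
    rw [add_comm n t, pow_add, mul_assoc, hone, mul_one, (h.walkInv_pow hθ t k l).2]
    congr 2
    rw [← Real.cos_neg]
    congr 1
    push_cast; ring

/-- The error of the transition from `∑ βₖ uₖ` to `∑ βₖ wₖ` by polynomials of the walk. -/
theorem transition_error [Fintype κ] (h : ReflectionPair Z₁ Z₃ u w s)
    (hpos : ∀ k, 0 < s k) {L : ℕ} {P : ℂ[X]}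
    (hP : ∀ b : ℂ, ‖b‖ = 1 → 0 < b.re →
      1 - (P.eval (b ^ 2) * star b ^ (4 * (L - 1) + 1)).re ≤ 3 / (L ^ 2 * b.re ^ 2))
    {l : List (Matrix Bool Bool ℂ)} (hl : ∀ R ∈ l, R ∈ Matrix.unitaryGroup Bool ℂ)
    (hlP : rotationPolys l false = P) (β : κ → ℂ) :
    let x := ∑ k, β k • u k
    let y := ∑ k, β k • w k
    let ψ : Bool → ι → ℂ := fun c =>
      (Z₁ * Z₃) ^ (2 * (L - 1)) *ᵥ (aeval (Z₃ * Z₁) (rotationPolys l c) *ᵥ x)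
    (star (ψ false - y) ⬝ᵥ (ψ false - y)).re + (star (ψ true) ⬝ᵥ ψ true).re ≤
      6 / L ^ 2 * ∑ k, ‖β k‖ ^ 2 / s k ^ 2 := by
  intro x y ψ
  have hW : Z₃ * Z₁ ∈ Matrix.unitaryGroup ι ℂ := by
    rw [Matrix.mem_unitaryGroup_iff, Matrix.star_eq_conjTranspose, Matrix.conjTranspose_mul,
      h.herm₁, h.herm₃, mul_assoc, ← mul_assoc Z₁, h.sq₁, one_mul, h.sq₃]
  have hV : Z₁ * Z₃ ∈ Matrix.unitaryGroup ι ℂ := by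
    rw [Matrix.mem_unitaryGroup_iff, Matrix.star_eq_conjTranspose, Matrix.conjTranspose_mul,
      h.herm₁, h.herm₃, mul_assoc, ← mul_assoc Z₃, h.sq₃, one_mul, h.sq₁]
  set T := 2 * (L - 1) with hT
  have hVT : (Z₁ * Z₃) ^ T ∈ Matrix.unitaryGroup ι ℂ := pow_mem hV T
  -- Conservation of norm replaces any computation of the complementary component: the error becomes
  -- `‖x‖² + ‖y‖² - 2 Re ⟨y, ψ false⟩`.
  have hn : star (ψ false) ⬝ᵥ ψ false + star (ψ true) ⬝ᵥ ψ true = star x ⬝ᵥ x := by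
    rw [← sum_rotationPolys hW l hl x, Fintype.sum_bool, add_comm]
    simp only [ψ, ← hT, star_mulVec_dotProduct_mulVec hVT]
  have hsum : ∀ a : κ → ι → ℂ, (∀ k l, star (a k) ⬝ᵥ a l = if k = l then 1 else 0) →
      star (∑ k, β k • a k) ⬝ᵥ (∑ k, β k • a k) = ((∑ k, ‖β k‖ ^ 2 : ℝ) : ℂ) := by
    intro a ha
    simp only [star_sum, star_smul, sum_dotProduct, dotProduct_sum, smul_dotProduct,
      dotProduct_smul, ha, smul_eq_mul, mul_ite, mul_one, mul_zero, Finset.sum_ite_eq',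
      Finset.mem_univ, if_true, Complex.ofReal_sum]
    refine Finset.sum_congr rfl fun k _ => ?_
    rw [← mul_star_self_eq, mul_comm]
  have hx := hsum u h.left
  have hy := hsum w h.right
  set θ : κ → ℝ := fun k => Real.arccos (s k) with hθ
  have hcos : ∀ k, s k = Real.cos (θ k) := fun k =>
    (Real.cos_arccos (by linarith [hpos k]) (h.le_one k)).symm
  set S : κ → ℂ := fun k => ∑ j ∈ Finset.range (P.natDegree + 1),
    P.coeff j * (Real.cos ((2 * ((j : ℝ) - T) - 1) * θ k) : ℂ) with hS
  -- Overlaps between different planes vanish, so the inner product is diagonal in `k`.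
  have hip : star y ⬝ᵥ ψ false = ∑ k, ((‖β k‖ ^ 2 : ℝ) : ℂ) * S k := by
    have e : ∀ k l', star (w k) ⬝ᵥ ((Z₁ * Z₃) ^ T *ᵥ (aeval (Z₃ * Z₁) P *ᵥ u l')) =
        if k = l' then S k else 0 := by
      intro k l'
      rw [aeval_eq_sum_range, Matrix.sum_mulVec, Matrix.mulVec_sum, dotProduct_sum]
      simp only [Matrix.smul_mulVec, Matrix.mulVec_smul, dotProduct_smul,
        Matrix.mulVec_mulVec, h.walkInv_pow_mul_walk_pow hcos, smul_eq_mul]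
      split_ifs with hk
      · rfl
      · simp
    simp only [ψ, x, y, hlP, ← hT]
    simp only [star_sum, star_smul, Matrix.mulVec_sum, Matrix.mulVec_smul, sum_dotProduct,
      dotProduct_sum, smul_dotProduct, dotProduct_smul, e, smul_eq_mul, mul_ite, mul_zero,
      Finset.sum_ite_eq', Finset.mem_univ, if_true]
    refine Finset.sum_congr rfl fun k _ => ?_
    rw [← mul_star_self_eq]; ring
  -- Each cosine is the mean of `exp (± i ·)`, so `S k` is the mean of the approximated expressions
  -- at `b = exp (i θ k)` and at its conjugate, both with real part `s k`.
  have hSre : ∀ k, 1 - (S k).re ≤ 3 / (L ^ 2 * s k ^ 2) := by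
    intro k
    set b : ℂ := Complex.exp (θ k * Complex.I) with hb
    have hb1 : ‖b‖ = 1 := Complex.norm_exp_ofReal_mul_I _
    have hbre : b.re = s k := by rw [hb, Complex.exp_ofReal_mul_I_re, hcos]
    have hsb : star b = Complex.exp (-(θ k * Complex.I)) := by
      rw [star_eq_inv_of_norm_one hb1, Complex.exp_neg]
    have e1 : 2 * S k = P.eval (b ^ 2) * star b ^ (4 * (L - 1) + 1) +
        P.eval (star b ^ 2) * b ^ (4 * (L - 1) + 1) := by
      have hd : 4 * (L - 1) = 2 * T := by omega
      rw [hd, eval_eq_sum_range, eval_eq_sum_range, Finset.sum_mul, Finset.sum_mul,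
        ← Finset.sum_add_distrib, hS, Finset.mul_sum]
      refine Finset.sum_congr rfl fun j _ => ?_
      rw [hsb, hb, ← Complex.exp_nat_mul, ← Complex.exp_nat_mul, ← Complex.exp_nat_mul,
        ← Complex.exp_nat_mul, ← Complex.exp_nat_mul, ← Complex.exp_nat_mul, mul_assoc,
        mul_assoc, ← Complex.exp_add, ← Complex.exp_add, Complex.ofReal_cos, Complex.cos]
      have a1 : ∀ a b c d : ℂ, a = c → b = d → 2 * (P.coeff j * ((Complex.exp a +
          Complex.exp b) / 2)) = P.coeff j * Complex.exp c + P.coeff j * Complex.exp d := by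
        rintro a b _ _ rfl rfl; ring
      apply a1 <;> push_cast <;> ring
    have p1 := hP b hb1 (by rw [hbre]; exact hpos k)
    have p2 := hP (star b) (by rw [norm_star, hb1])
      (by rw [Complex.star_def, Complex.conj_re, hbre]; exact hpos k)
    rw [star_star] at p2
    have hre2 : (star b).re = s k := by rw [Complex.star_def, Complex.conj_re, hbre]
    rw [hbre] at p1
    rw [hre2] at p2
    have e2 := congrArg Complex.re e1
    rw [Complex.add_re] at e2
    simp only [Complex.mul_re, Complex.re_ofNat, Complex.im_ofNat, zero_mul, sub_zero] at e2 p1 p2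
    linarith
  have hyψ : (star (ψ false) ⬝ᵥ y).re = (star y ⬝ᵥ ψ false).re := by
    rw [← star_dotProduct_comm]; rfl
  have hre := congrArg Complex.re hn
  have hxr := congrArg Complex.re hx
  have hyr := congrArg Complex.re hy
  have hipr := congrArg Complex.re hip
  rw [Complex.ofReal_re] at hxr hyr
  rw [Complex.add_re] at hre
  rw [Complex.re_sum] at hipr
  simp only [Complex.re_ofReal_mul] at hipr
  simp only [star_sub, sub_dotProduct, dotProduct_sub, Complex.sub_re]
  change (star x ⬝ᵥ x).re = _ at hxr
  change (star y ⬝ᵥ y).re = _ at hyr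
  have hfin : ∑ k, ‖β k‖ ^ 2 - ∑ k, ‖β k‖ ^ 2 * (S k).re ≤
      3 / L ^ 2 * ∑ k, ‖β k‖ ^ 2 / s k ^ 2 := by
    rw [← Finset.sum_sub_distrib, Finset.mul_sum]
    refine Finset.sum_le_sum fun k _ => ?_
    calc ‖β k‖ ^ 2 - ‖β k‖ ^ 2 * (S k).re = ‖β k‖ ^ 2 * (1 - (S k).re) := by ring
      _ ≤ ‖β k‖ ^ 2 * (3 / (L ^ 2 * s k ^ 2)) := by gcongr; exact hSre k
      _ = _ := by rw [← div_div]; ring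
  have h6 : 6 / (L : ℝ) ^ 2 * ∑ k, ‖β k‖ ^ 2 / s k ^ 2 =
      2 * (3 / L ^ 2 * ∑ k, ‖β k‖ ^ 2 / s k ^ 2) := by ring
  rw [h6]
  linarith

end ReflectionPair

end SingularVectorTransition

/-! ### The transition circuit, its operator, its running time, and its reflections. -/

noncomputable section Transition

open Polynomial

/-! ### The circuit -/

/-- The number of work qubits. -/
def workQubits (Q M : ℕ) : ℕ := Nat.clog 2 Q + 2 * Nat.clog 2 M + 2

instance (Q M : ℕ) : NeZero (workQubits Q M) := ⟨by simp [workQubits]⟩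

variable {Q M : ℕ}

/-- The bit strings `|i⟩|0⟩` with `i < Q`. -/
def rowFlag (Q M : ℕ) (y : DataQubit Q M → Bool) : Bool :=
  !foldBits (rowList Q M) false y && !foldBits [] false y

/-- The bit strings `|0⟩|j⟩` with `j` below `M` in both components. -/
def columnFlag (Q M : ℕ) (y : DataQubit Q M → Bool) : Bool :=
  !foldBits (columnList₁ Q M) false y && !foldBits (columnList₂ Q M) false y

def rowReflection (Q M : ℕ) (d : Bool → Bool) : Circuit Q M (workQubits Q M + 1) :=
  reflectionCircuit d (rowList Q M) [] (by
    simp only [rowList, List.length_append, length_compareList, List.length_nil, workQubits]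
    omega)

def columnReflection (Q M : ℕ) (d : Bool → Bool) : Circuit Q M (workQubits Q M + 1) :=
  reflectionCircuit d (columnList₁ Q M) (columnList₂ Q M) (by
    simp only [columnList₁, columnList₂, List.length_append, length_compareList, workQubits]
    omega)

/-- The walk, controlled by the control qubit. -/
def walkCircuit (Q M : ℕ) : Circuit Q M (workQubits Q M + 1) :=
  rowReflection Q M id ++ ([.useM, .useNInv] ++ (columnReflection Q M id ++ [.useN, .useMInv]))

/-- The inverse of the walk. -/
def walkInvCircuit (Q M : ℕ) : Circuit Q M (workQubits Q M + 1) :=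
  [.useM, .useNInv] ++ (columnReflection Q M (fun _ => true) ++
    ([.useN, .useMInv] ++ rowReflection Q M (fun _ => true)))

/-- Controlled walks interleaved with rotations of the control qubit. -/
def rotationCircuit (Q M : ℕ) :
    List (Matrix.unitaryGroup Bool ℂ) → Circuit Q M (workQubits Q M + 1)
  | [] => []
  | R :: l => rotationCircuit Q M l ++ (walkCircuit Q M ++
      [.gate 1 (by norm_num) (controlQubit (DataQubit Q M) (workQubits Q M))
        ⟨qubitGate R.1, qubitGate_mem R.2⟩])

def repeatCircuit {a : ℕ} (c : Circuit Q M a) : ℕ → Circuit Q M a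
  | 0 => []
  | n + 1 => repeatCircuit c n ++ c

/-- The circuit of the singular vector transition. -/
def transitionCircuit (Q M : ℕ) (l : List (Matrix.unitaryGroup Bool ℂ)) (n : ℕ) :
    Circuit Q M (workQubits Q M + 1) :=
  rotationCircuit Q M l ++ (repeatCircuit (walkInvCircuit Q M) n ++
    ([.useM, .useNInv] ++ swapCircuit Q M _))

section Semantics

variable (UM UN : Matrix.unitaryGroup (DataQubit Q M → Bool) ℂ)

/-- The unitary whose block from `|i⟩|0⟩` to `|0⟩|j⟩` is the given matrix up to a factor. -/
def blockUnitary : Matrix (DataQubit Q M → Bool) (DataQubit Q M → Bool) ℂ := (UN⁻¹ * UM).1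

theorem blockUnitary_mem : blockUnitary UM UN ∈ Matrix.unitaryGroup _ ℂ := (UN⁻¹ * UM).2

def reflection₁ (Q M : ℕ) : Matrix (DataQubit Q M → Bool) (DataQubit Q M → Bool) ℂ :=
  signMatrix (rowFlag Q M)

/-- The reflection in the preimage under `B` of the column states. -/
def reflection₃ : Matrix (DataQubit Q M → Bool) (DataQubit Q M → Bool) ℂ :=
  (blockUnitary UM UN)ᴴ * (signMatrix (columnFlag Q M) * blockUnitary UM UN)

variable {n : ℕ} (Ψ : Bool → (DataQubit Q M → Bool) → ℂ)

theorem circuitOp_block :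
    circuitOp UM UN ([.useM, .useNInv] : Circuit Q M (n + 1)) *ᵥ controlledState Ψ =
      controlledState fun c => blockUnitary UM UN *ᵥ Ψ c := by
  simp only [circuitOp, one_mul, Step.op]
  rw [← Matrix.mulVec_mulVec, actOn_inl_controlledState, actOn_inl_controlledState]
  simp only [Matrix.mulVec_mulVec]
  rfl

theorem circuitOp_blockInv :
    circuitOp UM UN ([.useN, .useMInv] : Circuit Q M (n + 1)) *ᵥ controlledState Ψ =
      controlledState fun c => (blockUnitary UM UN)ᴴ *ᵥ Ψ c := by
  simp only [circuitOp, one_mul, Step.op]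
  rw [← Matrix.mulVec_mulVec, actOn_inl_controlledState, actOn_inl_controlledState]
  simp only [Matrix.mulVec_mulVec]
  have : (blockUnitary UM UN)ᴴ = (UM⁻¹).1 * UN.1 := by
    have h : ((UN⁻¹ * UM)⁻¹).1 = (UM⁻¹).1 * UN.1 := by rw [mul_inv_rev, inv_inv]; rfl
    rw [← h]; rfl
  rw [this]

theorem circuitOp_rowReflection (d : Bool → Bool) :
    circuitOp UM UN (rowReflection Q M d) *ᵥ controlledState Ψ =
      controlledState fun c => if d c then reflection₁ Q M *ᵥ Ψ c else Ψ c :=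
  circuitOp_reflectionCircuit UM UN d _ _ _ Ψ

theorem circuitOp_columnReflection (d : Bool → Bool) :
    circuitOp UM UN (columnReflection Q M d) *ᵥ controlledState Ψ =
      controlledState fun c => if d c then signMatrix (columnFlag Q M) *ᵥ Ψ c else Ψ c :=
  circuitOp_reflectionCircuit UM UN d _ _ _ Ψ

/-- Only the two reflections carry a control: when it is off, `B` and `Bᴴ` cancel. Hence no
controlled use of the loaders is needed. -/
theorem circuitOp_walkCircuit :
    circuitOp UM UN (walkCircuit Q M) *ᵥ controlledState Ψ =
      controlledState fun c => if c then
        (reflection₃ UM UN * reflection₁ Q M) *ᵥ Ψ c else Ψ c := by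
  simp only [walkCircuit, circuitOp_append, ← Matrix.mulVec_mulVec, circuitOp_rowReflection,
    circuitOp_block, circuitOp_columnReflection, circuitOp_blockInv]
  congr 1
  funext c
  cases c
  · have := Matrix.mem_unitaryGroup_iff'.1 (blockUnitary_mem UM UN)
    rw [Matrix.star_eq_conjTranspose] at this
    simp [Matrix.mulVec_mulVec, this]
  · simp [Matrix.mulVec_mulVec, reflection₃, mul_assoc]

theorem circuitOp_walkInvCircuit :
    circuitOp UM UN (walkInvCircuit Q M) *ᵥ controlledState Ψ =
      controlledState fun c => (reflection₁ Q M * reflection₃ UM UN) *ᵥ Ψ c := by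
  simp only [walkInvCircuit, circuitOp_append, ← Matrix.mulVec_mulVec, circuitOp_rowReflection,
    circuitOp_block, circuitOp_columnReflection, circuitOp_blockInv, if_true]
  simp [Matrix.mulVec_mulVec, reflection₃]

/-- The recursion of `rotationPolys` with the walk in place of `X`: a controlled walk multiplies the
second component and a control gate mixes the two. -/
theorem circuitOp_rotationCircuit (l : List (Matrix.unitaryGroup Bool ℂ))
    (x : (DataQubit Q M → Bool) → ℂ) :
    circuitOp UM UN (rotationCircuit Q M l) *ᵥ controlledState (fun c => if c then 0 else x) =
      controlledState fun c => aeval (reflection₃ UM UN * reflection₁ Q M)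
        (rotationPolys (l.map Subtype.val) c) *ᵥ x := by
  induction l with
  | nil =>
    rw [rotationCircuit, circuitOp, Matrix.one_mulVec]
    congr 1
    funext c
    cases c <;> simp [rotationPolys]
  | cons R l ih =>
    rw [rotationCircuit, circuitOp_append, ← Matrix.mulVec_mulVec, ih, circuitOp_append,
      ← Matrix.mulVec_mulVec, circuitOp_walkCircuit, circuitOp, circuitOp, one_mul]
    refine (actOn_controlQubit R.1 _).trans ?_
    congr 1
    funext c
    simp only [List.map_cons, rotationPolys, map_add, map_mul, aeval_C, aeval_X,
      Matrix.add_mulVec, ← Matrix.mulVec_mulVec, Algebra.algebraMap_eq_smul_one,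
      Matrix.smul_mulVec, Matrix.one_mulVec]
    simp

theorem circuitOp_repeatCircuit (V : Matrix (DataQubit Q M → Bool) (DataQubit Q M → Bool) ℂ)
    (c : Circuit Q M (n + 1)) (hc : ∀ Ψ : Bool → (DataQubit Q M → Bool) → ℂ,
      circuitOp UM UN c *ᵥ controlledState Ψ = controlledState fun b => V *ᵥ Ψ b) (m : ℕ) :
    circuitOp UM UN (repeatCircuit c m) *ᵥ controlledState Ψ =
      controlledState fun b => V ^ m *ᵥ Ψ b := by
  induction m with
  | zero => simp [repeatCircuit, circuitOp]
  | succ m ih =>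
    rw [repeatCircuit, circuitOp_append, ← Matrix.mulVec_mulVec, ih, hc]
    simp only [Matrix.mulVec_mulVec, pow_succ']

theorem circuitOp_transitionCircuit (l : List (Matrix.unitaryGroup Bool ℂ)) (m : ℕ)
    (x : (DataQubit Q M → Bool) → ℂ) :
    circuitOp UM UN (transitionCircuit Q M l m) *ᵥ
        controlledState (fun c => if c then 0 else x) =
      controlledState fun c y => (blockUnitary UM UN *ᵥ
        ((reflection₁ Q M * reflection₃ UM UN) ^ m *ᵥ
          (aeval (reflection₃ UM UN * reflection₁ Q M)
            (rotationPolys (l.map Subtype.val) c) *ᵥ x))) (swapData y) := by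
  rw [transitionCircuit, circuitOp_append, ← Matrix.mulVec_mulVec, circuitOp_rotationCircuit,
    circuitOp_append, ← Matrix.mulVec_mulVec, circuitOp_repeatCircuit UM UN _ _ _
      (circuitOp_walkInvCircuit UM UN), circuitOp_append, ← Matrix.mulVec_mulVec,
    circuitOp_block, circuitOp_swapCircuit]

end Semantics

/-! ### Running time -/

theorem circuitTime_walkCircuit (τ : ℝ) :
    circuitTime τ (walkCircuit Q M) ≤ 4 * workQubits Q M + 4 * τ := by
  have h1 : circuitTime τ (rowReflection Q M id) ≤ 2 * workQubits Q M :=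
    circuitTime_reflectionCircuit τ _ _ _ _
  have h2 : circuitTime τ (columnReflection Q M id) ≤ 2 * workQubits Q M :=
    circuitTime_reflectionCircuit τ _ _ _ _
  simp only [walkCircuit, circuitTime_append]
  simp only [circuitTime, List.map_cons, List.map_nil, List.sum_cons, List.sum_nil,
    Step.time] at h1 h2 ⊢
  linarith

theorem circuitTime_walkInvCircuit (τ : ℝ) :
    circuitTime τ (walkInvCircuit Q M) ≤ 4 * workQubits Q M + 4 * τ := by
  have h1 : circuitTime τ (rowReflection Q M fun _ => true) ≤ 2 * workQubits Q M :=
    circuitTime_reflectionCircuit τ _ _ _ _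
  have h2 : circuitTime τ (columnReflection Q M fun _ => true) ≤ 2 * workQubits Q M :=
    circuitTime_reflectionCircuit τ _ _ _ _
  simp only [walkInvCircuit, circuitTime_append]
  simp only [circuitTime, List.map_cons, List.map_nil, List.sum_cons, List.sum_nil,
    Step.time] at h1 h2 ⊢
  linarith

theorem circuitTime_rotationCircuit (τ : ℝ) (l : List (Matrix.unitaryGroup Bool ℂ)) :
    circuitTime τ (rotationCircuit Q M l) ≤ l.length * (4 * workQubits Q M + 4 * τ + 1) := by
  induction l with
  | nil => simp [rotationCircuit, circuitTime]
  | cons R l ih =>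
    have h := circuitTime_walkCircuit (Q := Q) (M := M) τ
    rw [rotationCircuit, circuitTime_append, circuitTime_append, List.length_cons]
    simp only [circuitTime, List.map_cons, List.map_nil, List.sum_cons, List.sum_nil,
      Step.time] at ih h ⊢
    push_cast
    linarith

theorem circuitTime_repeatCircuit {a : ℕ} (τ : ℝ) (c : Circuit Q M a) (m : ℕ) :
    circuitTime τ (repeatCircuit c m) = m * circuitTime τ c := by
  induction m with
  | zero => simp [repeatCircuit, circuitTime]
  | succ m ih => rw [repeatCircuit, circuitTime_append, ih]; push_cast; ring

/-- About `4 L` controlled and `2 L` inverse walks; the slack in `6 L` pays for the final block and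
the exchange of registers. -/
theorem circuitTime_transitionCircuit {τ : ℝ} (hτ : 0 ≤ τ)
    {L : ℕ} (hL : 1 ≤ L) {l : List (Matrix.unitaryGroup Bool ℂ)}
    (hl : l.length = 4 * (L - 1) + 1) :
    circuitTime τ (transitionCircuit Q M l (2 * (L - 1))) ≤
      6 * L * (4 * workQubits Q M + 4 * τ + 1) := by
  have h1 := circuitTime_rotationCircuit (Q := Q) (M := M) τ l
  have h2 := circuitTime_walkInvCircuit (Q := Q) (M := M) τ
  obtain ⟨K, rfl⟩ := Nat.exists_eq_add_of_le' hL
  rw [Nat.add_sub_cancel] at hl ⊢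
  rw [hl] at h1
  have h3 : ((Nat.clog 2 M : ℕ) : ℝ) ≤ workQubits Q M := by
    exact_mod_cast (by simp only [workQubits]; omega : Nat.clog 2 M ≤ workQubits Q M)
  have h4 : ((2 * K : ℕ) : ℝ) * circuitTime τ (walkInvCircuit Q M) ≤
      (2 * K : ℕ) * (4 * workQubits Q M + 4 * τ) := by gcongr
  rw [transitionCircuit, circuitTime_append, circuitTime_append, circuitTime_append,
    circuitTime_repeatCircuit, circuitTime_swapCircuit]
  have h5 : circuitTime τ ([.useM, .useNInv] : Circuit Q M (workQubits Q M + 1)) = 2 * τ := by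
    simp [circuitTime, Step.time]; ring
  rw [h5]
  push_cast at h1 h4 ⊢
  have hw : (0 : ℝ) ≤ workQubits Q M := Nat.cast_nonneg _
  have hK : (0 : ℝ) ≤ K := Nat.cast_nonneg _
  nlinarith

/-- From `2 ^ (clog 2 n - 1) ≤ n` and `1 / log 2 < 2`. -/
theorem clog_two_le (n : ℕ) (hn : 1 ≤ n) : (Nat.clog 2 n : ℝ) ≤ 1 + 2 * Real.log n := by
  rcases eq_or_lt_of_le hn with rfl | hn
  · simp
  · have h := Nat.pow_pred_clog_lt_self one_lt_two hn
    have hpos : 0 < Nat.clog 2 n := Nat.clog_pos one_lt_two hn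
    have h1 : ((2 : ℝ)) ^ (Nat.clog 2 n - 1) ≤ n := by exact_mod_cast h.le
    have h2 := Real.log_le_log (by positivity) h1
    rw [Real.log_pow, Nat.cast_sub hpos] at h2
    have h3 := Real.log_two_gt_d9
    have h4 : (1 : ℝ) ≤ Nat.clog 2 n := by exact_mod_cast hpos
    push_cast at h2
    nlinarith

theorem workQubits_le (hQ : 1 ≤ Q) (hM : 1 ≤ M) :
    (workQubits Q M : ℝ) ≤ 5 * (1 + Real.log (Q * M)) := by
  have h1 := clog_two_le Q hQ
  have h2 := clog_two_le M hM
  have hQ' : (1 : ℝ) ≤ Q := by exact_mod_cast hQ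
  have hM' : (1 : ℝ) ≤ M := by exact_mod_cast hM
  rw [Real.log_mul (by positivity) (by positivity)]
  have h3 := Real.log_nonneg hQ'
  have h4 := Real.log_nonneg hM'
  simp only [workQubits]
  push_cast
  linarith

/-! ### The reflections of the steering matrix -/

theorem sum_star_mul_of_orthonormal {κ α : Type*} [Fintype α] [DecidableEq κ]
    {u : κ → EuclideanSpace ℂ α} (h : Orthonormal ℂ u) (k l : κ) :
    ∑ i, star (u k i) * u l i = if k = l then 1 else 0 := by
  rw [← orthonormal_iff_ite.1 h k l, EuclideanSpace.inner_eq_star_dotProduct, dotProduct]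
  exact Finset.sum_congr rfl fun i _ => by rw [mul_comm]; rfl

/-- The projections of `B u` onto the columns and of `Bᴴ v` (exchanged) onto the rows are `σ / F`
times the partner vector; the reflection formulas follow from `1 - 2 Π`. -/
theorem reflectionPair_steeringMatrix (hQ : 1 ≤ Q) (hM : 1 ≤ M) (d lam : ℝ) (θ : Fin Q → ℝ)
    {UM UN : Matrix.unitaryGroup (DataQubit Q M → Bool) ℂ}
    (hUM : IsRowLoader (steeringMatrix M d lam θ) UM.1)
    (hUN : IsNormLoader (steeringMatrix M d lam θ) UN.1) {r : ℕ} {σ : Fin r → ℝ}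
    {u : Fin r → EuclideanSpace ℂ (Fin Q)} {v : Fin r → EuclideanSpace ℂ (Fin M × Fin M)}
    (h : IsEconomySVD (steeringMatrix M d lam θ) σ u v) :
    ReflectionPair (reflection₁ Q M) (reflection₃ UM UN)
      (fun k => placeAt (rowIndex M) (u k))
      (fun k => (blockUnitary UM UN)ᴴ *ᵥ placeAt (columnIndex Q) fun j => v k j.swap)
      (fun k => σ k / frobeniusNorm (steeringMatrix M d lam θ)) := by
  set A := steeringMatrix M d lam θ with hA
  set F := frobeniusNorm A with hF
  set B := blockUnitary UM UN with hB
  have hBB : Bᴴ * B = 1 := Matrix.mem_unitaryGroup_iff'.1 (blockUnitary_mem UM UN)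
  have hBB' : B * Bᴴ = 1 := Matrix.mem_unitaryGroup_iff.1 (blockUnitary_mem UM UN)
  have hrow : ∀ y, rowFlag Q M y = true ↔ ∃ i : Fin Q, rowIndex M i = y := rowFlag_eq hQ
  have hcol : ∀ y, columnFlag Q M y = true ↔ ∃ j, columnIndex Q j = y := columnFlag_eq hM
  have hherm : ∀ f : (DataQubit Q M → Bool) → Bool, (signMatrix f)ᴴ = signMatrix f := fun f => by
    rw [signMatrix, Matrix.diagonal_conjTranspose]
    congr 1; funext y
    by_cases hy : f y <;> simp [hy]
  have hsq : ∀ f : (DataQubit Q M → Bool) → Bool, signMatrix f * signMatrix f = 1 := fun f => by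
    have := Matrix.mem_unitaryGroup_iff.1 (signMatrix_mem f)
    rwa [Matrix.star_eq_conjTranspose, hherm] at this
  have hov : ∀ i j, (B *ᵥ Pi.single (rowIndex M i) 1) (columnIndex Q j) = A i j / (F : ℂ) := by
    intro i j
    rw [← loader_overlap hUM hUN (fun i => by
      rw [rowNorm_steeringMatrix]; exact_mod_cast (by omega : M ≠ 0)) i j,
      star_mulVec_dotProduct, Matrix.mulVec_mulVec]
    change _ = star (Pi.single (columnIndex Q j) 1 : (DataQubit Q M → Bool) → ℂ) ⬝ᵥ
      (B *ᵥ Pi.single (rowIndex M i) 1)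
    rw [← Pi.single_star, star_one, single_one_dotProduct]
  have hBu : ∀ (x : Fin Q → ℂ) j, (B *ᵥ placeAt (rowIndex M) x) (columnIndex Q j) =
      ∑ i, x i * (A i j / (F : ℂ)) := by
    intro x j
    rw [placeAt, Matrix.mulVec_sum, Finset.sum_apply]
    refine Finset.sum_congr rfl fun i _ => ?_
    rw [Matrix.mulVec_smul, Pi.smul_apply, hov, smul_eq_mul]
  have hBv : ∀ (x : Fin M × Fin M → ℂ) i, (Bᴴ *ᵥ placeAt (columnIndex Q) x) (rowIndex M i) =
      ∑ j, star (A i j / (F : ℂ)) * x j := by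
    intro x i
    have e : (Bᴴ *ᵥ placeAt (columnIndex Q) x) (rowIndex M i) =
        star (Pi.single (rowIndex M i) 1 : (DataQubit Q M → Bool) → ℂ) ⬝ᵥ
          (Bᴴ *ᵥ placeAt (columnIndex Q) x) := by
      rw [← Pi.single_star, star_one, single_one_dotProduct]
    rw [e, ← star_mulVec_dotProduct, dotProduct_placeAt]
    simp only [Pi.star_apply, hov]
  have hFstar : star (F : ℂ) = F := Complex.conj_ofReal _
  have hswap : ∀ i j, A i j = star (A i j.swap) := fun i j => by
    rw [hA, star_steeringMatrix, Prod.swap_swap]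
  -- This is `Aᵀ u k`, not `Aᴴ u k`. Rewriting `A` by `hswap` conjugates the left singular vectors,
  -- after which orthonormality applies.
  have hAu : ∀ k j, ∑ i, u k i * (A i j / (F : ℂ)) = (σ k / F : ℝ) * v k j.swap := by
    intro k j
    have e : ∀ i, u k i * (A i j / (F : ℂ)) =
        ∑ l, (σ l / F : ℂ) * v l j.swap * (star (u l i) * u k i) := fun i => by
      rw [hswap, h.eq_sum, star_sum, Finset.sum_div, Finset.mul_sum]
      refine Finset.sum_congr rfl fun l _ => ?_
      have : star (σ l : ℂ) = σ l := Complex.conj_ofReal _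
      rw [star_mul', star_mul', this, star_star]; ring
    simp only [e]
    rw [Finset.sum_comm]
    simp only [← Finset.mul_sum, sum_star_mul_of_orthonormal h.left_orthonormal]
    simp
  have hAv : ∀ k i, ∑ j, star (A i j / (F : ℂ)) * v k j.swap = (σ k / F : ℝ) * u k i := by
    intro k i
    have e : ∀ j : Fin M × Fin M, star (A i j / (F : ℂ)) * v k j.swap =
        ∑ l, (σ l / F : ℂ) * u l i * (star (v l j.swap) * v k j.swap) := fun j => by
      rw [star_div₀, hFstar, hswap, star_star, h.eq_sum, Finset.sum_div, Finset.sum_mul]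
      exact Finset.sum_congr rfl fun l _ => by ring
    simp only [e]
    rw [Finset.sum_comm]
    have hsw : ∀ l, ∑ j : Fin M × Fin M, star (v l j.swap) * v k j.swap =
        if l = k then 1 else 0 := fun l => by
      rw [← sum_star_mul_of_orthonormal h.right_orthonormal l k]
      exact (Equiv.prodComm (Fin M) (Fin M)).sum_comp fun j => star (v l j) * v k j
    simp only [← Finset.mul_sum, hsw]
    simp
  have hsmul : ∀ {α : Type} [Fintype α] (f : α → (DataQubit Q M → Bool)) (c : ℂ) (x : α → ℂ),
      placeAt f (fun a => c * x a) = c • placeAt f x := fun f c x => by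
    simp only [placeAt, Finset.smul_sum, mul_smul]
  have hstar : ∀ (k l : Fin r), (star fun j : Fin M × Fin M => v k j.swap) ⬝ᵥ
      (fun j : Fin M × Fin M => v l j.swap) = if k = l then 1 else 0 := fun k l => by
    rw [← sum_star_mul_of_orthonormal h.right_orthonormal k l]
    exact (Equiv.prodComm (Fin M) (Fin M)).sum_comp fun j => star (v k j) * v l j
  constructor
  · exact hherm _
  · rw [reflection₃, ← hB, Matrix.conjTranspose_mul, Matrix.conjTranspose_mul, hherm,
      Matrix.conjTranspose_conjTranspose, mul_assoc]
  · exact hsq _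
  · rw [reflection₃, ← hB]
    calc _ = Bᴴ * (signMatrix (columnFlag Q M) * ((B * Bᴴ) * (signMatrix (columnFlag Q M) * B))) := by
            simp only [mul_assoc]
      _ = 1 := by rw [hBB', one_mul, ← mul_assoc (signMatrix _), hsq, one_mul, hBB]
  · intro k l
    rw [star_placeAt_dotProduct rowIndex_injective,
      ← sum_star_mul_of_orthonormal h.left_orthonormal k l]
    rfl
  · intro k l
    rw [star_mulVec_dotProduct, Matrix.conjTranspose_conjTranspose, Matrix.mulVec_mulVec, hBB',
      Matrix.one_mulVec, star_placeAt_dotProduct columnIndex_injective, hstar]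
  · intro k
    exact signMatrix_mulVec_placeAt rowIndex_injective hrow _
  · intro k
    rw [reflection₁, signMatrix_mulVec_eq_sub rowIndex_injective hrow]
    simp only [hBv, hAv, hsmul, smul_smul, Complex.ofReal_div]
  · intro k
    rw [reflection₃, ← hB, ← Matrix.mulVec_mulVec, ← Matrix.mulVec_mulVec,
      signMatrix_mulVec_eq_sub columnIndex_injective hcol, Matrix.mulVec_sub, Matrix.mulVec_mulVec,
      hBB, Matrix.one_mulVec]
    simp only [hBu, hAu, hsmul, smul_smul, Matrix.mulVec_smul, Complex.ofReal_div]
  · intro k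
    rw [reflection₃, ← hB, ← Matrix.mulVec_mulVec, ← Matrix.mulVec_mulVec,
      Matrix.mulVec_mulVec _ B, hBB', Matrix.one_mulVec,
      signMatrix_mulVec_placeAt columnIndex_injective hcol, Matrix.mulVec_neg]

end Transition

/-! ### Error of the circuit in the Euclidean norm of the full register. -/

noncomputable section FinalError

open Polynomial

variable {Q M : ℕ}

theorem withAncillas_succ (n : ℕ) (ψ : (DataQubit Q M → Bool) → ℂ) :
    withAncillas (n + 1) ψ = controlledState fun c => if c then 0 else ψ := by
  funext x
  rw [withAncillas, controlledState]
  simp only [Fin.forall_fin_succ]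
  by_cases h : ∀ t : Fin n, x (Sum.inr t.succ) = false
  · rw [if_pos h]
    cases hx : x (Sum.inr 0)
    · simp [h]
    · simp
  · rw [if_neg h, if_neg fun h' => h h'.2]

theorem norm_sq_controlledState {δ : Type*} [Fintype δ] [DecidableEq δ] {n : ℕ}
    (Ψ : Bool → (δ → Bool) → ℂ) :
    ‖WithLp.toLp 2 (controlledState (n := n) Ψ)‖ ^ 2 = ∑ c, (star (Ψ c) ⬝ᵥ Ψ c).re := by
  simp only [star_dotProduct_self, Complex.ofReal_re]
  rw [EuclideanSpace.norm_sq_eq, ← Fintype.sum_prod_type']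
  symm
  refine Fintype.sum_of_injective
    (fun p : Bool × (δ → Bool) => (Sum.elim p.2 (Fin.cons p.1 fun _ => false) :
      δ ⊕ Fin (n + 1) → Bool)) ?_ _ _ ?_ ?_
  · rintro ⟨c, y⟩ ⟨c', y'⟩ h
    refine Prod.ext ?_ (funext fun k => ?_)
    · simpa using congrFun h (Sum.inr 0)
    · exact congrFun h (Sum.inl k)
  · intro x hx
    have : ¬ ∀ t : Fin n, x (Sum.inr t.succ) = false := fun h => hx ⟨(x (Sum.inr 0), x ∘ Sum.inl), by
      funext w
      rcases w with w | w
      · rfl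
      · refine Fin.cases ?_ (fun t => ?_) w
        · rfl
        · simp [h t]⟩
    simp [controlledState, this]
  · rintro ⟨c, y⟩
    simp [controlledState, Sum.elim_comp_inl]

theorem controlledState_sub {δ : Type*} {n : ℕ} (Ψ Φ : Bool → (δ → Bool) → ℂ) :
    controlledState (n := n) Ψ - controlledState Φ = controlledState (Ψ - Φ) := by
  funext x
  simp only [controlledState, Pi.sub_apply]
  split_ifs <;> simp

theorem star_swapData_dotProduct (x y : (DataQubit Q M → Bool) → ℂ) :
    (star fun b => x (swapData b)) ⬝ᵥ (fun b => y (swapData b)) = star x ⬝ᵥ y := by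
  have hinv : Function.Involutive (swapData : (DataQubit Q M → Bool) → _) := fun y => by
    funext w; rcases w with w | w | w <;> rfl
  exact Equiv.sum_comp hinv.toPerm fun b => star (x b) * y b

theorem rowState_sum (n : ℕ) {r : ℕ} (β : Fin r → ℂ) (u : Fin r → EuclideanSpace ℂ (Fin Q)) :
    rowState M (n + 1) (∑ k, β k • u k) =
      controlledState fun c => if c then 0 else ∑ k, β k • placeAt (rowIndex M) (u k) := by
  rw [← placeAt_sum_smul, ← withAncillas_succ, rowState]
  congr 1
  simp only [placeAt, WithLp.ofLp_sum, WithLp.ofLp_smul]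
  rfl

theorem columnState_sum (n : ℕ) {r : ℕ} (β : Fin r → ℂ)
    (v : Fin r → EuclideanSpace ℂ (Fin M × Fin M)) :
    columnState Q (n + 1) (∑ k, β k • v k) =
      controlledState fun c => if c then 0 else ∑ k, β k • placeAt (columnIndex Q) (v k) := by
  rw [← placeAt_sum_smul, ← withAncillas_succ, columnState]
  congr 1
  simp only [placeAt, WithLp.ofLp_sum, WithLp.ofLp_smul]
  rfl

theorem norm_sq_sum_placeAt {α : Type*} [Fintype α] {f : α → (DataQubit Q M → Bool)}
    (hf : Function.Injective f) (n : ℕ) {r : ℕ} (β : Fin r → ℂ)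
    {u : Fin r → EuclideanSpace ℂ α} (hu : Orthonormal ℂ u) :
    ‖WithLp.toLp 2 (controlledState (n := n) fun c =>
      if c then 0 else ∑ k, β k • placeAt f (u k))‖ ^ 2 = ∑ k, ‖β k‖ ^ 2 := by
  rw [norm_sq_controlledState, Fintype.sum_bool]
  simp only [if_true, Bool.false_eq_true, if_false, dotProduct_zero, Complex.zero_re, zero_add]
  have hs : ∀ k l, star (u k).ofLp ⬝ᵥ (u l).ofLp = if k = l then 1 else 0 :=
    sum_star_mul_of_orthonormal hu
  have : star (∑ k, β k • placeAt f (u k)) ⬝ᵥ (∑ k, β k • placeAt f (u k)) =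
      ((∑ k, ‖β k‖ ^ 2 : ℝ) : ℂ) := by
    simp only [star_sum, star_smul, sum_dotProduct, dotProduct_sum, smul_dotProduct,
      dotProduct_smul, star_placeAt_dotProduct hf, hs, smul_eq_mul, mul_ite, mul_one, mul_zero,
      Finset.sum_ite_eq', Finset.mem_univ, if_true, Complex.ofReal_sum]
    exact Finset.sum_congr rfl fun k _ => by rw [← mul_star_self_eq]
  rw [this, Complex.ofReal_re]

theorem frobeniusNorm_steeringMatrix_pos (hQ : 1 ≤ Q) (hM : 1 ≤ M) {d lam : ℝ}
    {θ : Fin Q → ℝ} : 0 < frobeniusNorm (steeringMatrix M d lam θ) := by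
  rw [frobeniusNorm_steeringMatrix]
  have : (0 : ℝ) < Q := by exact_mod_cast hQ
  have : (0 : ℝ) < M := by exact_mod_cast hM
  positivity

/-- The final `B` and the exchange are isometries taking `w k` to `v k`, so the error is that of the
walk polynomials, with `s k = σ k / F`. -/
theorem transitionCircuit_error (hQ : 1 ≤ Q) (hM : 1 ≤ M) {d lam : ℝ} {θ : Fin Q → ℝ}
    {UM UN : Matrix.unitaryGroup (DataQubit Q M → Bool) ℂ}
    (hUM : IsRowLoader (steeringMatrix M d lam θ) UM.1)
    (hUN : IsNormLoader (steeringMatrix M d lam θ) UN.1) {r : ℕ} {σ : Fin r → ℝ}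
    {u : Fin r → EuclideanSpace ℂ (Fin Q)} {v : Fin r → EuclideanSpace ℂ (Fin M × Fin M)}
    (h : IsEconomySVD (steeringMatrix M d lam θ) σ u v) (β : Fin r → ℂ)
    {L : ℕ} {P : ℂ[X]}
    (hP : ∀ b : ℂ, ‖b‖ = 1 → 0 < b.re →
      1 - (P.eval (b ^ 2) * star b ^ (4 * (L - 1) + 1)).re ≤ 3 / (L ^ 2 * b.re ^ 2))
    {l : List (Matrix.unitaryGroup Bool ℂ)} (hl : rotationPolys (l.map Subtype.val) false = P) :
    ‖WithLp.toLp 2 (circuitOp UM UN (transitionCircuit Q M l (2 * (L - 1))) *ᵥ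
        rowState M _ (∑ i, β i • u i)) -
      WithLp.toLp 2 (columnState Q _ (∑ i, β i • v i))‖ ^ 2 ≤
      6 * frobeniusNorm (steeringMatrix M d lam θ) ^ 2 / L ^ 2 *
        ∑ k, ‖β k‖ ^ 2 / σ k ^ 2 := by
  have hF := frobeniusNorm_steeringMatrix_pos hQ hM (d := d) (lam := lam) (θ := θ)
  set F := frobeniusNorm (steeringMatrix M d lam θ) with hFdef
  have hpair := reflectionPair_steeringMatrix hQ hM d lam θ hUM hUN h
  have herr := hpair.transition_error (fun k => div_pos (h.pos k) hF) hP
    (l := l.map Subtype.val) (fun R hR => by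
      obtain ⟨R', -, rfl⟩ := List.mem_map.1 hR
      exact R'.2) hl β
  simp only at herr
  set B := blockUnitary UM UN with hB
  have hBB' : B * Bᴴ = 1 := Matrix.mem_unitaryGroup_iff.1 (blockUnitary_mem UM UN)
  set x := ∑ k, β k • placeAt (rowIndex M) (u k).ofLp with hx
  set y := ∑ k, β k • (Bᴴ *ᵥ placeAt (columnIndex Q) fun j => v k j.swap) with hy
  set ψ : Bool → (DataQubit Q M → Bool) → ℂ := fun c =>
    (reflection₁ Q M * reflection₃ UM UN) ^ (2 * (L - 1)) *ᵥ
      (aeval (reflection₃ UM UN * reflection₁ Q M) (rotationPolys (l.map Subtype.val) c) *ᵥ x)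
    with hψ
  have hBy : (fun b => (B *ᵥ y) (swapData b)) =
      ∑ k, β k • placeAt (columnIndex Q) (v k).ofLp := by
    have : B *ᵥ y = placeAt (columnIndex Q)
        (fun j => (∑ k, β k • (v k).ofLp) j.swap) := by
      have e : (fun j : Fin M × Fin M => (∑ k, β k • (v k).ofLp) j.swap) =
          ∑ k, β k • fun j : Fin M × Fin M => v k j.swap := by
        funext j; simp [Finset.sum_apply]
      rw [e, placeAt_sum_smul, hy, Matrix.mulVec_sum]
      refine Finset.sum_congr rfl fun k _ => ?_
      rw [Matrix.mulVec_smul, Matrix.mulVec_mulVec, hBB', Matrix.one_mulVec]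
    rw [this, placeAt_columnIndex_swap, placeAt_sum_smul]
  rw [rowState_sum, columnState_sum, circuitOp_transitionCircuit, ← WithLp.toLp_sub,
    controlledState_sub, norm_sq_controlledState, Fintype.sum_bool]
  have e1 : ((fun c b => (B *ᵥ ψ c) (swapData b)) - fun c => if c = true then 0 else
      ∑ k, β k • placeAt (columnIndex Q) (v k).ofLp : Bool → (DataQubit Q M → Bool) → ℂ) true =
      fun b => (B *ᵥ ψ true) (swapData b) := by
    funext b; simp
  have e2 : ((fun c b => (B *ᵥ ψ c) (swapData b)) - fun c => if c = true then 0 else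
      ∑ k, β k • placeAt (columnIndex Q) (v k).ofLp : Bool → (DataQubit Q M → Bool) → ℂ) false =
      fun b => (B *ᵥ (ψ false - y)) (swapData b) := by
    rw [← hBy, Matrix.mulVec_sub]; funext b; simp
  rw [e1, e2, star_swapData_dotProduct, star_swapData_dotProduct,
    star_mulVec_dotProduct_mulVec (blockUnitary_mem UM UN),
    star_mulVec_dotProduct_mulVec (blockUnitary_mem UM UN), add_comm]
  refine herr.trans (le_of_eq ?_)
  rw [Finset.mul_sum, Finset.mul_sum]
  refine Finset.sum_congr rfl fun k _ => ?_
  have := h.pos k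
  field_simp
  rfl

/-- As `σ k ≤ F`, both states have norm at most `F √(∑ |β k|² / σ k²)`, so even doing nothing meets
this bound. -/
theorem empty_circuit_error (hQ : 1 ≤ Q) (hM : 1 ≤ M) {d lam : ℝ} {θ : Fin Q → ℝ}
    {UM UN : Matrix.unitaryGroup (DataQubit Q M → Bool) ℂ}
    (hUM : IsRowLoader (steeringMatrix M d lam θ) UM.1)
    (hUN : IsNormLoader (steeringMatrix M d lam θ) UN.1) {r : ℕ} {σ : Fin r → ℝ}
    {u : Fin r → EuclideanSpace ℂ (Fin Q)} {v : Fin r → EuclideanSpace ℂ (Fin M × Fin M)}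
    (h : IsEconomySVD (steeringMatrix M d lam θ) σ u v) (β : Fin r → ℂ) (n : ℕ) :
    ‖WithLp.toLp 2 (rowState M (n + 1) (∑ i, β i • u i)) -
      WithLp.toLp 2 (columnState Q (n + 1) (∑ i, β i • v i))‖ ≤
      2 * frobeniusNorm (steeringMatrix M d lam θ) * √(∑ k, ‖β k‖ ^ 2 / σ k ^ 2) := by
  have hF := frobeniusNorm_steeringMatrix_pos hQ hM (d := d) (lam := lam) (θ := θ)
  have hpair := reflectionPair_steeringMatrix hQ hM d lam θ hUM hUN h
  set F := frobeniusNorm (steeringMatrix M d lam θ)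
  have hbound : √(∑ k, ‖β k‖ ^ 2) ≤ F * √(∑ k, ‖β k‖ ^ 2 / σ k ^ 2) := by
    rw [← Real.sqrt_sq hF.le, ← Real.sqrt_mul (sq_nonneg F), Finset.mul_sum]
    refine Real.sqrt_le_sqrt (Finset.sum_le_sum fun k _ => ?_)
    have h1 := hpair.le_one k
    have h2 := h.pos k
    rw [div_le_one hF] at h1
    rw [mul_div_assoc', le_div_iff₀ (by positivity), mul_comm (F ^ 2)]
    gcongr
  refine (norm_sub_le _ _).trans ?_
  rw [rowState_sum, columnState_sum]
  have h1 := norm_sq_sum_placeAt (M := M) rowIndex_injective n β h.left_orthonormal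
  have h2 := norm_sq_sum_placeAt (Q := Q) columnIndex_injective n β h.right_orthonormal
  rw [← Real.sqrt_sq (norm_nonneg (WithLp.toLp 2 (controlledState fun c =>
    if c = true then 0 else ∑ k, β k • placeAt (rowIndex M) (u k).ofLp))), h1,
    ← Real.sqrt_sq (norm_nonneg (WithLp.toLp 2 (controlledState fun c =>
    if c = true then 0 else ∑ k, β k • placeAt (columnIndex Q) (v k).ofLp))), h2]
  linarith

end FinalError

theorem theorem1 (c₀ : ℝ) (hc₀ : 0 ≤ c₀) (k₀ : ℕ) :
    ∃ (C : ℝ) (k : ℕ), 0 < C ∧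
      ∀ (Q M : ℕ), 1 ≤ Q → 1 ≤ M → ∀ ε : ℝ, 0 < ε →
        ∃ (a : ℕ) (T : Circuit Q M a),
          ∀ (d lam : ℝ), 0 < lam → d = lam / 2 → ∀ θ : Fin Q → ℝ, StrictMono θ →
            circuitTime (c₀ * (1 + Real.log (Q * M)) ^ k₀) T ≤
              C * (frobeniusNorm (steeringMatrix M d lam θ) *
                (1 + Real.log (Q * M)) ^ k / ε) ∧
            ∀ UM UN : Matrix.unitaryGroup (DataQubit Q M → Bool) ℂ,
              IsRowLoader (steeringMatrix M d lam θ) UM.1 →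
              IsNormLoader (steeringMatrix M d lam θ) UN.1 →
              ∀ (r : ℕ) (σ : Fin r → ℝ) (u : Fin r → EuclideanSpace ℂ (Fin Q))
                (v : Fin r → EuclideanSpace ℂ (Fin M × Fin M)),
                IsEconomySVD (steeringMatrix M d lam θ) σ u v →
                ∀ β : Fin r → ℂ,
                  ‖WithLp.toLp 2 (circuitOp UM UN T *ᵥ rowState M a (∑ i, β i • u i)) -
                      WithLp.toLp 2 (columnState Q a (∑ i, β i • v i))‖ ≤
                    ε * √(∑ i, ‖β i‖ ^ 2 / σ i ^ 2) := by
  -- `30 = 6 · 5` from the number of walks and the bound on `L`; `21 = 4 · 5 + 1` from the work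
  -- qubits and one rotation.
  refine ⟨30 * (21 + 4 * c₀), k₀ + 1, by positivity, fun Q M hQ hM ε hε => ?_⟩
  have hQ' : (1 : ℝ) ≤ Q := by exact_mod_cast hQ
  have hM' : (1 : ℝ) ≤ M := by exact_mod_cast hM
  set ℓ : ℝ := 1 + Real.log (Q * M) with hℓ
  have hℓ1 : 1 ≤ ℓ := by
    have := Real.log_nonneg (one_le_mul_of_one_le_of_one_le hQ' hM')
    linarith
  have hℓ0 : 0 ≤ ℓ := by linarith
  have hF : ∀ (d lam : ℝ) (θ : Fin Q → ℝ),
      frobeniusNorm (steeringMatrix M d lam θ) = √Q * M := frobeniusNorm_steeringMatrix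
  set F : ℝ := √Q * M with hFdef
  have hFpos : 0 < F := by positivity
  -- For coarse accuracy the empty circuit is used, since a circuit with at least one step could
  -- exceed a time bound that tends to zero as `ε` grows.
  rcases le_or_gt (2 * F) ε with hlarge | hsmall
  · refine ⟨workQubits Q M + 1, [], fun d lam _ _ θ _ => ⟨?_, ?_⟩⟩
    · rw [hF]
      simp only [circuitTime, List.map_nil, List.sum_nil]
      positivity
    · intro UM UN hUM hUN r σ u v h β
      rw [circuitOp, Matrix.one_mulVec]
      refine (empty_circuit_error hQ hM hUM hUN h β _).trans ?_
      rw [hF]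
      gcongr
  -- `L ≥ 3 F / ε` gives `6 F² / L² ≤ ε²`, while `ε < 2 F` absorbs the rounding into `L ≤ 5 F / ε`.
  · set L : ℕ := ⌈3 * F / ε⌉₊ with hL
    have hLpos : 1 ≤ L := Nat.one_le_ceil_iff.2 (by positivity)
    have hLge : 3 * F / ε ≤ L := Nat.le_ceil _
    have hLle : (L : ℝ) ≤ 5 * (F / ε) := by
      have h1 := Nat.ceil_lt_add_one (by positivity : 0 ≤ 3 * F / ε)
      have h2 : 1 < 2 * (F / ε) := by
        rw [← mul_div_assoc, lt_div_iff₀ hε]; linarith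
      rw [mul_div_assoc] at h1
      rw [hL, mul_div_assoc]
      linarith
    obtain ⟨P, hPdeg, hPlt, hPerr⟩ := exists_half_power_polynomial hLpos
    obtain ⟨q, hq, hPq⟩ := exists_complementary hPdeg hPlt
    obtain ⟨l, hlen, hlu, hlP, -⟩ := exists_rotationPolys _ P q hPdeg hq hPq
    lift l to List (Matrix.unitaryGroup Bool ℂ) using hlu
    rw [List.length_map] at hlen
    refine ⟨_, transitionCircuit Q M l (2 * (L - 1)), fun d lam _ _ θ _ => ⟨?_, ?_⟩⟩
    · refine (circuitTime_transitionCircuit (by positivity) hLpos hlen).trans ?_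
      rw [hF]
      have h1 := workQubits_le hQ hM
      rw [← hℓ] at h1
      have h2 : ℓ ≤ ℓ ^ (k₀ + 1) := le_self_pow₀ hℓ1 (by omega)
      have h3 : ℓ ^ k₀ ≤ ℓ ^ (k₀ + 1) := pow_le_pow_right₀ hℓ1 (by omega)
      have h4 : c₀ * ℓ ^ k₀ ≤ c₀ * ℓ ^ (k₀ + 1) := by gcongr
      have h5 : 4 * (workQubits Q M : ℝ) + 4 * (c₀ * ℓ ^ k₀) + 1 ≤
          (21 + 4 * c₀) * ℓ ^ (k₀ + 1) := by nlinarith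
      calc 6 * (L : ℝ) * (4 * workQubits Q M + 4 * (c₀ * ℓ ^ k₀) + 1)
          ≤ 6 * (5 * (F / ε)) * ((21 + 4 * c₀) * ℓ ^ (k₀ + 1)) := by gcongr
        _ = _ := by ring
    · intro UM UN hUM hUN r σ u v h β
      have herr := transitionCircuit_error hQ hM hUM hUN h β hPerr hlP
      rw [hF] at herr
      set S := ∑ k, ‖β k‖ ^ 2 / σ k ^ 2 with hS
      have hS0 : 0 ≤ S := Finset.sum_nonneg fun k _ => by positivity
      refine le_of_sq_le_sq ?_ (by positivity)
      refine herr.trans ?_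
      rw [mul_pow ε, Real.sq_sqrt hS0]
      refine mul_le_mul_of_nonneg_right ?_ hS0
      have hLr : (0 : ℝ) < L := by exact_mod_cast hLpos
      rw [div_le_iff₀ (by positivity)]
      rw [div_le_iff₀ hε] at hLge
      have : (3 * F) ^ 2 ≤ (L * ε) ^ 2 := pow_le_pow_left₀ (by positivity) hLge 2
      nlinarith
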